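/- Let $n\ge 1$ and let $\widetilde J(x_1,\dots,x_{n+1},y_1,\dots,y_{n+1})=(y_1,\dots,y_{n+1},x_1,\dots,x_{n+1})$ be the standard para-complex structure on $\mathbb R^{2n+2}$, with its flat connection $\mathrm D$. Let $f\colon M^{2n+1}\to\mathbb R^{2n+2}$ be a $\widetilde J$-tangent affine hypersphere with shape operator $\lambda\,\mathrm{id}$, $\lambda\in\mathbb R$. That is, $f$ is a smooth immersion with a smooth transversal field $C$ such that, writing $\mathrm D_Xf_*Y=f_*(\nabla_XY)+h(X,Y)C$ and $\mathrm D_XC=-f_*(SX)+\tau(X)C$: the form $h$ is nondegenerate; the metric volume form $\omega_h$ (equal to $|\det[h(X_i,X_j)]|^{1/2}$ on bases that are positively oriented for $\Theta$) is $\nabla$-parallel and coincides with $\Theta(X_1,\dots,X_{2n+1})=\det[f_*X_1,\dots,f_*X_{2n+1},C]$; $S=\lambda\,\mathrm{id}$; and $\widetilde JC_x\in f_*(T_xM)$ for all $x\in M$. Let $V\subset\mathbb R^{2n}$ be open and non-empty and let $g\colon V\to\mathbb R^{2n+2}$ be a para-complex affine hypersphere with shape operator $\alpha\,\mathrm{id}$,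 $\alpha\in\mathbb R$. That is, $g$ is a smooth immersion, $g_*(T_xV)$ is $\widetilde J$-invariant for all $x\in V$, with $\pm1$-eigenspaces of $\widetilde J$ on it of equal dimension, and there is a smooth $\zeta\colon V\to\mathbb R^{2n+2}$ such that $\mathrm{span}\{\zeta,\widetilde J\zeta\}$ is complementary to $g_*(TV)$ and, writing $\mathrm D_Xg_*Y=g_*(\nabla_XY)+h_1(X,Y)\zeta+h_2(X,Y)\widetilde J\zeta$ and $\mathrm D_X\zeta=-g_*(\widetilde SX)+\tau_1(X)\zeta+\tau_2(X)\widetilde J\zeta$: the form $h_1$ is nondegenerate; $|\det[h_1(X_i,X_j)]|=1$ whenever $\det(g_*X_1,\dots,g_*X_{2n},\zeta,\widetilde J\zeta)=1$; $\tau_1=\tau_2=0$; and $\widetilde S=\alpha\,\mathrm{id}$. Suppose that $f$ and $g$ are related, in the sense that on some coordinate domain of $M$, with coordinates $(x,z)=(x_1,\dots,x_{2n},z)$ ranging over $V\times I$ for a non-empty open interval $I$, $$f(x,z)=\widetilde J g(x)\cosh z-g(x)\sinh z .$$ Then $$|\lambda|=|\alpha|^{\frac{2n+4}{2n+3}} .$$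 -/

import Mathlib

open scoped Manifold ContDiff

noncomputable section

namespace AffineHypersphere

/-- The vector space `ℝᵏ`. Only its affine structure, the determinant and smoothness are used. -/
abbrev RVec (k : ℕ) : Type := Fin k → ℝ

/-- The determinant `det[w₁, …, w_k]` of `k` vectors of `ℝᵏ`. -/
def detVec {k : ℕ} (w : Fin k → RVec k) : ℝ := (Pi.basisFun ℝ (Fin k)).det w

/-- `D_X (F_* Y)` at `x`, for the coordinate (constant) vector fields `X = u` and `Y = v`. -/
def secondDeriv {m k : ℕ} (F : RVec m → RVec k) (x u v : RVec m) : RVec k :=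
  fderiv ℝ (fun y => fderiv ℝ F y v) x u

/-! ### Hypersurfaces, in local coordinates -/

/-- `F : U → ℝᵐ⁺¹` is a smooth immersion of the open set `U ⊆ ℝᵐ`, and `C` is a smooth
transversal vector field along `F`. -/
structure IsTransversalPair {m : ℕ} (U : Set (RVec m)) (F C : RVec m → RVec (m + 1)) :
    Prop where
  isOpen : IsOpen U
  smooth : ContDiffOn ℝ ∞ F U
  smooth_field : ContDiffOn ℝ ∞ C U
  immersion : ∀ x ∈ U, Function.Injective (fderiv ℝ F x)
  transversal : ∀ x ∈ U, IsCompl (LinearMap.range (fderiv ℝ F x).toLinearMap) (ℝ ∙ C x)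

/-- The formulas of Gauss and Weingarten
`D_X F_*Y = F_*(∇_X Y) + h(X,Y) C` and `D_X C = -F_*(S X) + τ(X) C`, written for coordinate vector
fields; `Γ x u v` is `∇_u v` for these, so that `∇_X Y = D_X Y + Γ(X, Y)` in general. For a
transversal `C` the formulas determine `Γ, h, S, τ` on `U`. -/
structure IsInduced {m : ℕ} (U : Set (RVec m)) (F C : RVec m → RVec (m + 1))
    (Γ : RVec m → RVec m →ₗ[ℝ] RVec m →ₗ[ℝ] RVec m)
    (h : RVec m → LinearMap.BilinForm ℝ (RVec m))
    (S : RVec m → Module.End ℝ (RVec m))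
    (τ : RVec m → Module.Dual ℝ (RVec m)) : Prop where
  gauss : ∀ x ∈ U, ∀ u v,
    secondDeriv F x u v = fderiv ℝ F x (Γ x u v) + h x u v • C x
  weingarten : ∀ x ∈ U, ∀ u,
    fderiv ℝ C x u = -(fderiv ℝ F x (S x u)) + τ x u • C x

/-- The induced volume element `Θ(X₁, …, X_m) = det[F_*X₁, …, F_*X_m, C]`. -/
def inducedVolume {m : ℕ} (F C : RVec m → RVec (m + 1)) (x : RVec m) (X : Fin m → RVec m) : ℝ :=
  detVec (Fin.snoc (α := fun _ => RVec (m + 1)) (fun i => fderiv ℝ F x (X i)) (C x))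

/-- The metric volume form `ω_h` for the orientation given by the volume element `Θ`: it is
`|det[h(X_i, X_j)]|^{1/2}` on positively oriented bases, the negative of this on negatively
oriented ones, and `0` on linearly dependent vectors. -/
def metricVolume {m : ℕ} (Θ : RVec m → (Fin m → RVec m) → ℝ)
    (h : RVec m → LinearMap.BilinForm ℝ (RVec m)) (x : RVec m) (X : Fin m → RVec m) : ℝ :=
  Real.sign (Θ x X) * √|(Matrix.of fun i j => h x (X i) (X j)).det|

/-- The `m`-form `vol` is parallel on `U` for the connection with coefficients `Γ`:
`u(vol(X₁, …, X_m)) = ∑ᵢ vol(X₁, …, ∇_u X_i, …, X_m)` for coordinate vector fields. -/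
def IsParallel {m : ℕ} (U : Set (RVec m)) (Γ : RVec m → RVec m →ₗ[ℝ] RVec m →ₗ[ℝ] RVec m)
    (vol : RVec m → (Fin m → RVec m) → ℝ) : Prop :=
  ∀ x ∈ U, ∀ (u : RVec m) (X : Fin m → RVec m),
    fderiv ℝ (fun y => vol y X) x u = ∑ i, vol x (Function.update X i (Γ x u (X i)))

/-- `F : U → ℝᵐ⁺¹` is nondegenerate, `C` is an affine normal (Blaschke) field for it, and the
shape operator is `S = c • id`. -/
def IsLocalHypersphere {m : ℕ} (U : Set (RVec m)) (F C : RVec m → RVec (m + 1)) (c : ℝ) : Prop :=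
  IsTransversalPair U F C ∧
  ∃ Γ h S τ, IsInduced U F C Γ h S τ ∧
    (∀ x ∈ U, (h x).Nondegenerate) ∧
    IsParallel U Γ (metricVolume (inducedVolume F C) h) ∧
    (∀ x ∈ U, ∀ X, metricVolume (inducedVolume F C) h x X = inducedVolume F C x X) ∧
    ∀ x ∈ U, S x = c • LinearMap.id

/-! ### Affine hyperspheres on manifolds -/

/-- `f : M → ℝᵐ⁺¹` with the Blaschke field `C` is an affine hypersphere with shape operator
`c • id`; all the conditions are tensorial and are expressed in the smooth charts of `M`. -/
def IsAffineHypersphere {m : ℕ} {M : Type*} [TopologicalSpace M] [ChartedSpace (RVec m) M]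
    (f C : M → RVec (m + 1)) (c : ℝ) : Prop :=
  ∀ e ∈ IsManifold.maximalAtlas 𝓘(ℝ, RVec m) ∞ M,
    IsLocalHypersphere e.target (f ∘ e.symm) (C ∘ e.symm) c

/-- The index exchange `i ↔ i + (n + 1)` on `2n + 2` indices. -/
def swapIndex (n : ℕ) (i : Fin (2 * n + 2)) : Fin (2 * n + 2) :=
  if hi : i.val < n + 1 then ⟨i.val + (n + 1), by omega⟩ else ⟨i.val - (n + 1), by omega⟩

/-- The standard para-complex structure on `ℝ²ⁿ⁺²`,
`J(x₁, …, x_{n+1}, y₁, …, y_{n+1}) = (y₁, …, y_{n+1}, x₁, …, x_{n+1})`. -/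
def paraJ (n : ℕ) : Module.End ℝ (RVec (2 * n + 2)) := LinearMap.funLeft ℝ ℝ (swapIndex n)

/-- `J C_x` is tangent to the hypersurface `f` at every point. -/
def IsJTangent {n : ℕ} {M : Type*} [TopologicalSpace M] [ChartedSpace (RVec (2 * n + 1)) M]
    (f C : M → RVec (2 * n + 2)) : Prop :=
  ∀ e ∈ IsManifold.maximalAtlas 𝓘(ℝ, RVec (2 * n + 1)) ∞ M, ∀ x ∈ e.target,
    paraJ n (C (e.symm x)) ∈ LinearMap.range (fderiv ℝ (f ∘ e.symm) x).toLinearMap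

/-- `f` is a `J`-tangent affine hypersphere with shape operator `c • id`: an affine hypersphere
whose Blaschke field is `J`-tangent. -/
def IsJTangentAffineHypersphere {n : ℕ} {M : Type*} [TopologicalSpace M]
    [ChartedSpace (RVec (2 * n + 1)) M] (f : M → RVec (2 * n + 2)) (c : ℝ) : Prop :=
  ∃ C : M → RVec (2 * n + 2), IsAffineHypersphere f C c ∧ IsJTangent f C

/-! ### Para-complex affine hyperspheres -/

/-- `g : V → ℝ²ⁿ⁺²` is a para-holomorphic hypersurface: a smooth immersion of the open set
`V ⊆ ℝ²ⁿ` whose tangent spaces are `J`-invariant and such that `J` restricts to a para-complex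
structure on them, that is, the eigenspaces for `1` and `-1` have the same dimension. -/
structure IsParaHolomorphicHypersurface {n : ℕ} (V : Set (RVec (2 * n)))
    (g : RVec (2 * n) → RVec (2 * n + 2)) : Prop where
  isOpen : IsOpen V
  smooth : ContDiffOn ℝ ∞ g V
  immersion : ∀ x ∈ V, Function.Injective (fderiv ℝ g x)
  invariant : ∀ x ∈ V, ∀ w ∈ LinearMap.range (fderiv ℝ g x).toLinearMap,
    paraJ n w ∈ LinearMap.range (fderiv ℝ g x).toLinearMap
  paraComplex : ∀ x ∈ V,
    Module.finrank ℝ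
      ↥(LinearMap.range (fderiv ℝ g x).toLinearMap ⊓ Module.End.eigenspace (paraJ n) 1) =
    Module.finrank ℝ
      ↥(LinearMap.range (fderiv ℝ g x).toLinearMap ⊓ Module.End.eigenspace (paraJ n) (-1))

/-- `ζ` is a smooth vector field along `g` for which `{ζ, Jζ}` spans a transversal bundle. -/
structure IsParaTransversal {n : ℕ} (V : Set (RVec (2 * n)))
    (g ζ : RVec (2 * n) → RVec (2 * n + 2)) : Prop where
  smooth : ContDiffOn ℝ ∞ ζ V
  transversal : ∀ x ∈ V, IsCompl (LinearMap.range (fderiv ℝ g x).toLinearMap)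
    (Submodule.span ℝ {ζ x, paraJ n (ζ x)})

/-- The formulas of Gauss and Weingarten in codimension two,
`D_X g_*Y = g_*(∇_X Y) + h₁(X,Y) ζ + h₂(X,Y) Jζ` and
`D_X ζ = -g_*(S X) + τ₁(X) ζ + τ₂(X) Jζ`, for coordinate vector fields. -/
structure IsParaInduced {n : ℕ} (V : Set (RVec (2 * n)))
    (g ζ : RVec (2 * n) → RVec (2 * n + 2))
    (Γ : RVec (2 * n) → RVec (2 * n) →ₗ[ℝ] RVec (2 * n) →ₗ[ℝ] RVec (2 * n))
    (h₁ h₂ : RVec (2 * n) → LinearMap.BilinForm ℝ (RVec (2 * n)))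
    (S : RVec (2 * n) → Module.End ℝ (RVec (2 * n)))
    (τ₁ τ₂ : RVec (2 * n) → Module.Dual ℝ (RVec (2 * n))) : Prop where
  gauss : ∀ x ∈ V, ∀ u v,
    secondDeriv g x u v =
      fderiv ℝ g x (Γ x u v) + h₁ x u v • ζ x + h₂ x u v • paraJ n (ζ x)
  weingarten : ∀ x ∈ V, ∀ u,
    fderiv ℝ ζ x u = -(fderiv ℝ g x (S x u)) + τ₁ x u • ζ x + τ₂ x u • paraJ n (ζ x)

/-- The volume form `θ_ζ(X₁, …, X_{2n}) = det(g_*X₁, …, g_*X_{2n}, ζ, Jζ)`. -/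
def paraVolume {n : ℕ} (g ζ : RVec (2 * n) → RVec (2 * n + 2)) (x : RVec (2 * n))
    (X : Fin (2 * n) → RVec (2 * n)) : ℝ :=
  detVec (Fin.snoc (α := fun _ => RVec (2 * n + 2))
    (Fin.snoc (α := fun _ => RVec (2 * n + 2)) (fun i => fderiv ℝ g x (X i)) (ζ x))
    (paraJ n (ζ x)))

/-- `g : V → ℝ²ⁿ⁺²` is a nondegenerate para-complex affine hypersphere with shape operator
`a • id`: for some `ζ` with `{ζ, Jζ}` transversal, `|H_ζ| = 1` and `τ₁ = 0` (an affine normal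
field), one has `τ₂ = 0` and `S = a • id`. It is proper if `a ≠ 0` and improper if `a = 0`.
Here `H_ζ = det[h₁(X_i, X_j)]` for any basis with `θ_ζ(X₁, …, X_{2n}) = 1`. -/
def IsParaComplexAffineHypersphere {n : ℕ} (V : Set (RVec (2 * n)))
    (g : RVec (2 * n) → RVec (2 * n + 2)) (a : ℝ) : Prop :=
  IsParaHolomorphicHypersurface V g ∧
  ∃ ζ, IsParaTransversal V g ζ ∧
    ∃ Γ h₁ h₂ S τ₁ τ₂, IsParaInduced V g ζ Γ h₁ h₂ S τ₁ τ₂ ∧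
      (∀ x ∈ V, (h₁ x).Nondegenerate) ∧
      (∀ x ∈ V, ∀ X : Fin (2 * n) → RVec (2 * n), paraVolume g ζ x X = 1 →
        |(Matrix.of fun i j => h₁ x (X i) (X j)).det| = 1) ∧
      (∀ x ∈ V, τ₁ x = 0) ∧
      (∀ x ∈ V, τ₂ x = 0) ∧
      ∀ x ∈ V, S x = a • LinearMap.id

/-- `g` is related to `f`: on a non-empty coordinate domain `V × I` of `M`, with coordinates
`(x₁, …, x_{2n}, z)` and `I` an open interval, `f` has the local expression
`f(x, z) = J g(x) cosh z - g(x) sinh z`. -/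
def IsRelated {n : ℕ} {M : Type*} [TopologicalSpace M] [ChartedSpace (RVec (2 * n + 1)) M]
    (f : M → RVec (2 * n + 2)) (V : Set (RVec (2 * n)))
    (g : RVec (2 * n) → RVec (2 * n + 2)) : Prop :=
  V.Nonempty ∧
  ∃ I : Set ℝ, IsOpen I ∧ I.OrdConnected ∧ I.Nonempty ∧
    ∃ e ∈ IsManifold.maximalAtlas 𝓘(ℝ, RVec (2 * n + 1)) ∞ M,
      e.target = {p | Fin.init (α := fun _ => ℝ) p ∈ V ∧ p (Fin.last (2 * n)) ∈ I} ∧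
      ∀ x ∈ V, ∀ z ∈ I,
        f (e.symm (Fin.snoc (α := fun _ => ℝ) x z)) =
          Real.cosh z • paraJ n (g x) - Real.sinh z • g x

end AffineHypersphere

end

open AffineHypersphere

noncomputable section

namespace AffineHypersphere

/-! ### Alternating maps and determinants of vectors -/

/-! Write R_z = cosh z J - sinh z (`hypRot`), so that f = R_z g and ∂_z R_z = -J R_z. Modulo the
tangent space of g, which J and R_z preserve, everything takes place in the para-complex line
spanned by g and Jg.

J-tangency forces C = R_z(g_*y + s g). Transversality of C gives s ≠ 0 and D = det[g_*e, g, Jg] ≠ 0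
(`exists_field_eq_hypRot`), and the Weingarten formula in the z-direction gives s = -λ
(`coefficient_eq_neg_of_weingarten`).

Decompose ζ = a g + b Jg + g_*Y and let K be J transported to the parameter domain. Comparing the
Gauss formulas of f and g gives s h = h₁(·, (a + bK)·) + dz² (`metric_of_eq_hypRot`). In coordinates
the normalisations read |det h| = s²D² and |det h₁| = (a² - b²)²D², while det(a + bK) = (a² - b²)ⁿ.
Taking determinants yields |a² - b²|ⁿ⁺² = |λ|²ⁿ⁺³ (`abs_pow_eq_of_eq_hypRot`).

It remains to see that ζ = -αg. By this identity |a² - b²| is constant, so det[g_*e, ζ, Jζ]² is a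
constant multiple of D². The logarithmic derivatives of the two determinants differ by 2h₁(·, Y),
hence Y = 0 by nondegeneracy (`IsParaInduced.exists_eq_combination`). Then ζ + αg is locally
constant with values in span{g, Jg}, and the immersion g moves in both null directions of J, which
forces it to vanish (`IsParaHolomorphicHypersurface.eq_neg_smul`). Thus a = -α and b = 0. -/

theorem alternatingMap_update_sum {ι R N P : Type*} [Fintype ι] [DecidableEq ι] [CommRing R]
    [AddCommGroup N] [Module R N] [AddCommGroup P] [Module R P]
    (f : N [⋀^ι]→ₗ[R] P) (m : ι → N) (i : ι) (c : ι → R) :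
    f (Function.update m i (∑ j, c j • m j)) = c i • f m := by
  rw [f.map_update_sum, Finset.sum_eq_single i]
  · rw [f.map_update_smul, Function.update_eq_self]
  · intro j _ hj
    rw [f.map_update_smul, f.map_update_self _ hj.symm, smul_zero]
  · simp

/-- The determinant of `m` vectors followed by two more. -/
def detPair {m : ℕ} (v : Fin m → RVec (m + 2)) (p q : RVec (m + 2)) : ℝ :=
  detVec (Fin.snoc (α := fun _ => RVec (m + 2)) (Fin.snoc (α := fun _ => RVec (m + 2)) v p) q)

section detPair

variable {m : ℕ} (v : Fin m → RVec (m + 2))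

theorem detPair_eq_update_right (p q q' : RVec (m + 2)) :
    detPair v p q' = (Pi.basisFun ℝ (Fin (m + 2))).det (Function.update
      (Fin.snoc (α := fun _ => RVec (m + 2)) (Fin.snoc (α := fun _ => RVec (m + 2)) v p) q)
      (Fin.last (m + 1)) q') := by
  rw [detPair, detVec, Fin.update_snoc_last]

theorem detPair_eq_update_left (p p' q : RVec (m + 2)) :
    detPair v p' q = (Pi.basisFun ℝ (Fin (m + 2))).det (Function.update
      (Fin.snoc (α := fun _ => RVec (m + 2)) (Fin.snoc (α := fun _ => RVec (m + 2)) v p) q)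
      (Fin.last m).castSucc p') := by
  rw [detPair, detVec, ← Fin.snoc_update, Fin.update_snoc_last]

theorem detPair_add_right (p q q' : RVec (m + 2)) :
    detPair v p (q + q') = detPair v p q + detPair v p q' := by
  simp only [detPair_eq_update_right v p 0, AlternatingMap.map_update_add]

theorem detPair_smul_right (p q : RVec (m + 2)) (c : ℝ) :
    detPair v p (c • q) = c * detPair v p q := by
  simp only [detPair_eq_update_right v p 0, AlternatingMap.map_update_smul, smul_eq_mul]

theorem detPair_add_left (p p' q : RVec (m + 2)) :
    detPair v (p + p') q = detPair v p q + detPair v p' q := by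
  simp only [detPair_eq_update_left v 0 _ q, AlternatingMap.map_update_add]

theorem detPair_smul_left (p q : RVec (m + 2)) (c : ℝ) :
    detPair v (c • p) q = c * detPair v p q := by
  simp only [detPair_eq_update_left v 0 _ q, AlternatingMap.map_update_smul, smul_eq_mul]

theorem detPair_self (p : RVec (m + 2)) : detPair v p p = 0 := by
  refine AlternatingMap.map_eq_zero_of_eq _ _
    (i := (Fin.last m).castSucc) (j := Fin.last (m + 1)) ?_ ?_
  · simp
  · exact (Fin.castSucc_lt_last _).ne

theorem detPair_swap (p q : RVec (m + 2)) : detPair v q p = -detPair v p q := by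
  have h := detPair_self v (p + q)
  rw [detPair_add_left, detPair_add_right, detPair_add_right, detPair_self, detPair_self] at h
  linarith

theorem detPair_right_eq_zero (p : RVec (m + 2)) {t : RVec (m + 2)}
    (ht : t ∈ Submodule.span ℝ (Set.range v)) : detPair v p t = 0 := by
  induction ht using Submodule.span_induction with
  | mem x hx =>
    obtain ⟨i, rfl⟩ := hx
    refine AlternatingMap.map_eq_zero_of_eq _ _
      (i := i.castSucc.castSucc) (j := Fin.last (m + 1)) ?_ ?_
    · simp
    · exact (Fin.castSucc_lt_last _).ne
  | zero => simpa using detPair_smul_right v p 0 0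
  | add x y _ _ hx hy => rw [detPair_add_right, hx, hy, add_zero]
  | smul c x _ hx => rw [detPair_smul_right, hx, mul_zero]

theorem detPair_left_eq_zero (p : RVec (m + 2)) {t : RVec (m + 2)}
    (ht : t ∈ Submodule.span ℝ (Set.range v)) : detPair v t p = 0 := by
  rw [detPair_swap, detPair_right_eq_zero v p ht, neg_zero]

/-- With q = Jp this is the effect of multiplying p by a + bJ, whose determinant on span{p, Jp} is
a² - b². Tangential errors do not contribute. -/
theorem detPair_combination {p q t t' : RVec (m + 2)} (a b : ℝ)
    (ht : t ∈ Submodule.span ℝ (Set.range v)) (ht' : t' ∈ Submodule.span ℝ (Set.range v)) :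
    detPair v (a • p + b • q + t) (b • p + a • q + t') = (a ^ 2 - b ^ 2) * detPair v p q := by
  simp only [detPair_add_left, detPair_add_right, detPair_smul_left, detPair_smul_right,
    detPair_self, detPair_left_eq_zero v _ ht, detPair_right_eq_zero v _ ht', detPair_swap v p q]
  ring

theorem detPair_map (L : Module.End ℝ (RVec (m + 2))) (p q : RVec (m + 2)) :
    detPair (fun i => L (v i)) (L p) (L q) = LinearMap.det L * detPair v p q := by
  rw [detPair, detPair, detVec, detVec, ← Module.Basis.det_comp]
  congr 1
  funext i
  refine Fin.lastCases ?_ (fun i => Fin.lastCases ?_ (fun i => ?_) i) i <;> simp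

/-- Cramer's rule; it turns the derivatives of the frame vectors into a trace. -/
theorem detPair_update (p q : RVec (m + 2)) (i : Fin m) (c : Fin m → ℝ) (x y : ℝ) :
    detPair (Function.update v i (∑ j, c j • v j + x • p + y • q)) p q
      = c i * detPair v p q := by
  have h := alternatingMap_update_sum (Pi.basisFun ℝ (Fin (m + 2))).det
    (Fin.snoc (α := fun _ => RVec (m + 2)) (Fin.snoc (α := fun _ => RVec (m + 2)) v p) q)
    i.castSucc.castSucc
    (Fin.snoc (α := fun _ => ℝ) (Fin.snoc (α := fun _ => ℝ) c x) y)
  simp only [Fin.sum_univ_castSucc, Fin.snoc_castSucc, Fin.snoc_last, ← Fin.snoc_update] at h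
  exact h

theorem detPair_ne_zero (p q : RVec (m + 2))
    (h : ∀ w, ∃ c : Fin m → ℝ, ∃ x y : ℝ, w = ∑ j, c j • v j + x • p + y • q) :
    detPair v p q ≠ 0 := by
  set w := Fin.snoc (α := fun _ => RVec (m + 2)) (Fin.snoc (α := fun _ => RVec (m + 2)) v p) q
    with hw
  have hs : ⊤ ≤ Submodule.span ℝ (Set.range w) := by
    intro u _
    obtain ⟨c, x, y, rfl⟩ := h u
    have hm : ∀ i, w i ∈ Submodule.span ℝ (Set.range w) :=
      fun i => Submodule.subset_span ⟨i, rfl⟩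
    refine add_mem (add_mem (sum_mem fun j _ => Submodule.smul_mem _ _ ?_)
      (Submodule.smul_mem _ _ ?_)) (Submodule.smul_mem _ _ ?_)
    · simpa [hw] using hm j.castSucc.castSucc
    · simpa [hw] using hm (Fin.last m).castSucc
    · simpa [hw] using hm (Fin.last (m + 1))
  have hli := linearIndependent_of_top_le_span_of_card_eq_finrank hs (by simp)
  exact (((Pi.basisFun ℝ (Fin (m + 2))).is_basis_iff_det).1 ⟨hli, top_le_iff.1 hs⟩).ne_zero

end detPair

/-! ### The para-complex structure -/

theorem paraJ_paraJ (n : ℕ) (w : RVec (2 * n + 2)) : paraJ n (paraJ n w) = w := by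
  funext i
  have h : swapIndex n (swapIndex n i) = i := by
    have hi := i.isLt
    by_cases h : i.val < n + 1
    · have h' : ¬i.val + (n + 1) < n + 1 := by omega
      ext
      simp only [swapIndex, h, h', dite_true, dite_false]
      omega
    · have h' : i.val - (n + 1) < n + 1 := by omega
      ext
      simp only [swapIndex, h, h', dite_true, dite_false]
      omega
  simp [paraJ, LinearMap.funLeft_apply, h]

/-- An involution K anticommuting with J conjugates a + bJ into a - bJ, and the product of these two
is the scalar a² - b². -/
theorem det_add_smul_involution_sq {W : Type*} [AddCommGroup W] [Module ℝ W]
    (J K : Module.End ℝ W) (hJ : ∀ w, J (J w) = w) (hK : ∀ w, K (K w) = w)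
    (hJK : ∀ w, K (J w) = -J (K w)) (a b : ℝ) :
    LinearMap.det (a • LinearMap.id + b • J : Module.End ℝ W) ^ 2
      = (a ^ 2 - b ^ 2) ^ Module.finrank ℝ W := by
  let e : W ≃ₗ[ℝ] W := LinearEquiv.ofInvolutive K hK
  have h1 : LinearMap.det (a • LinearMap.id + b • J : Module.End ℝ W)
      = LinearMap.det (a • LinearMap.id - b • J : Module.End ℝ W) := by
    rw [← LinearMap.det_conj _ e]
    congr 1
    ext w
    have he : e.symm w = K w := rfl
    have he' : ∀ w, e w = K w := fun _ => rfl
    simp [he, he', hJK, hK, sub_eq_add_neg]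
  have h2 : (a • LinearMap.id + b • J : Module.End ℝ W) * (a • LinearMap.id - b • J)
      = (a ^ 2 - b ^ 2) • LinearMap.id := by
    ext w
    simp only [Module.End.mul_apply, LinearMap.add_apply, LinearMap.sub_apply,
      LinearMap.smul_apply, LinearMap.id_apply, map_sub, map_smul, hJ]
    module
  rw [sq]
  nth_rewrite 2 [h1]
  rw [← map_mul, h2, LinearMap.det_smul, LinearMap.det_id, mul_one]

theorem det_add_smul_paraJ_sq (n : ℕ) (a b : ℝ) :
    LinearMap.det (a • LinearMap.id + b • paraJ n : Module.End ℝ (RVec (2 * n + 2))) ^ 2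
      = (a ^ 2 - b ^ 2) ^ (2 * n + 2) := by
  let K : Module.End ℝ (RVec (2 * n + 2)) :=
    LinearMap.pi fun i => (if i.val < n + 1 then (1 : ℝ) else -1) • LinearMap.proj i
  have hK : ∀ w i, K w i = (if i.val < n + 1 then (1 : ℝ) else -1) * w i := fun w i => by
    simp only [K, LinearMap.pi_apply, LinearMap.smul_apply, LinearMap.proj_apply, smul_eq_mul]
  rw [det_add_smul_involution_sq (paraJ n) K (paraJ_paraJ n)]
  · simp
  · intro w
    funext i
    simp only [hK]
    split_ifs <;> simp
  · intro w
    funext i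
    simp only [hK, Pi.neg_apply, paraJ, LinearMap.funLeft_apply, swapIndex]
    have := i.isLt
    split_ifs <;> simp_all <;> omega

/-- The determinant of `a + bJ` for an involution with eigenspaces of equal dimension. -/
theorem det_add_smul_involution {W : Type*} [AddCommGroup W] [Module ℝ W] [FiniteDimensional ℝ W]
    (J : Module.End ℝ W) (hJ : ∀ w, J (J w) = w) {p : ℕ}
    (h₁ : Module.finrank ℝ (Module.End.eigenspace J 1) = p)
    (h₂ : Module.finrank ℝ (Module.End.eigenspace J (-1)) = p) (a b : ℝ) :
    LinearMap.det (a • LinearMap.id + b • J : Module.End ℝ W) = (a ^ 2 - b ^ 2) ^ p ∧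
      Module.finrank ℝ W = 2 * p := by
  have hc : IsCompl (Module.End.eigenspace J 1) (Module.End.eigenspace J (-1)) := by
    constructor
    · rw [Submodule.disjoint_def]
      intro w h h'
      rw [Module.End.mem_eigenspace_iff] at h h'
      rw [h, one_smul] at h'
      have h3 : (2 : ℝ) • w = 0 := by
        rw [two_smul]; nth_rewrite 1 [h']; simp
      simpa using h3
    · rw [codisjoint_iff, eq_top_iff]
      intro w _
      refine Submodule.mem_sup.2 ⟨(2⁻¹ : ℝ) • (w + J w), ?_, (2⁻¹ : ℝ) • (w - J w), ?_, ?_⟩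
      · rw [Module.End.mem_eigenspace_iff]; simp [hJ, add_comm]
      · rw [Module.End.mem_eigenspace_iff, map_smul, map_sub, hJ]; module
      · module
  refine ⟨?_, ?_⟩
  -- On the two eigenspaces a + bJ acts as the scalars a + b and a - b.
  · let e := Submodule.prodEquivOfIsCompl _ _ hc
    have h : (a • LinearMap.id + b • J : Module.End ℝ W) = e.toLinearMap ∘ₗ
        (LinearMap.prodMap ((a + b) • LinearMap.id) ((a - b) • LinearMap.id)) ∘ₗ
        e.symm.toLinearMap := by
      rw [← LinearMap.comp_assoc, LinearEquiv.eq_comp_toLinearMap_symm]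
      refine LinearMap.ext fun ⟨⟨x, hx⟩, ⟨y, hy⟩⟩ => ?_
      rw [Module.End.mem_eigenspace_iff] at hx hy
      simp only [e, LinearMap.comp_apply, LinearEquiv.coe_coe, LinearMap.prodMap_apply,
        Submodule.coe_prodEquivOfIsCompl', LinearMap.add_apply, LinearMap.smul_apply,
        LinearMap.id_apply, map_add, hx, hy, Submodule.coe_smul]
      module
    rw [h, LinearMap.det_conj, LinearMap.det_prodMap, LinearMap.det_smul, LinearMap.det_smul,
      LinearMap.det_id, LinearMap.det_id, h₁, h₂, mul_one, mul_one, ← mul_pow]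
    congr 1
    ring
  · rw [← Submodule.finrank_add_eq_of_isCompl hc, h₁, h₂, two_mul]

theorem eq_zero_of_combination_mem_span {m : ℕ} {v : Fin m → RVec (m + 2)} {p q : RVec (m + 2)}
    (hD : detPair v p q ≠ 0) {x y : ℝ}
    (h : x • p + y • q ∈ Submodule.span ℝ (Set.range v)) : x = 0 ∧ y = 0 := by
  have h1 := detPair_left_eq_zero v q h
  have h2 := detPair_right_eq_zero v p h
  simp only [detPair_add_left, detPair_add_right, detPair_smul_left, detPair_smul_right,
    detPair_self, mul_zero, add_zero, zero_add, mul_eq_zero, hD, or_false] at h1 h2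
  exact ⟨h1, h2⟩

theorem exists_combination_of_detPair_ne_zero {m : ℕ} {v : Fin m → RVec (m + 2)}
    {p q : RVec (m + 2)} (hD : detPair v p q ≠ 0) (w : RVec (m + 2)) :
    ∃ x y : ℝ, ∃ t ∈ Submodule.span ℝ (Set.range v), w = x • p + y • q + t := by
  obtain ⟨-, hs⟩ := ((Pi.basisFun ℝ (Fin (m + 2))).is_basis_iff_det).2 (isUnit_iff_ne_zero.2 hD)
  have hw : w ∈ Submodule.span ℝ (Set.range (Fin.snoc (α := fun _ => RVec (m + 2))
    (Fin.snoc (α := fun _ => RVec (m + 2)) v p) q)) := hs ▸ Submodule.mem_top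
  obtain ⟨c, rfl⟩ := (Submodule.mem_span_range_iff_exists_fun ℝ).1 hw
  refine ⟨c (Fin.last m).castSucc, c (Fin.last (m + 1)),
    ∑ i : Fin m, c i.castSucc.castSucc • v i,
    sum_mem fun i _ => Submodule.smul_mem _ _ (Submodule.subset_span ⟨i, rfl⟩), ?_⟩
  simp only [Fin.sum_univ_castSucc, Fin.snoc_castSucc, Fin.snoc_last]
  abel

/-- The images of the coordinate vectors under the differential. -/
def frame {m k : ℕ} (g : RVec m → RVec k) (x : RVec m) (i : Fin m) : RVec k :=
  fderiv ℝ g x (Pi.single i 1)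

theorem fderiv_eq_sum_frame {m k : ℕ} (g : RVec m → RVec k) (x v : RVec m) :
    fderiv ℝ g x v = ∑ i, v i • frame g x i := by
  conv_lhs => rw [pi_eq_sum_univ' v]
  simp [frame, map_sum]

theorem span_frame {m k : ℕ} (g : RVec m → RVec k) (x : RVec m) :
    Submodule.span ℝ (Set.range (frame g x)) = LinearMap.range (fderiv ℝ g x).toLinearMap := by
  refine le_antisymm (Submodule.span_le.2 ?_) ?_
  · rintro _ ⟨i, rfl⟩
    exact ⟨Pi.single i 1, rfl⟩
  · rintro _ ⟨v, rfl⟩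
    rw [ContinuousLinearMap.coe_coe, fderiv_eq_sum_frame]
    exact sum_mem fun i _ => Submodule.smul_mem _ _ (Submodule.subset_span ⟨i, rfl⟩)

theorem fderiv_mem_span_frame {m k : ℕ} (g : RVec m → RVec k) (x v : RVec m) :
    fderiv ℝ g x v ∈ Submodule.span ℝ (Set.range (frame g x)) :=
  span_frame g x ▸ ⟨v, rfl⟩

/-! ### Differentiation -/

theorem hasFDerivAt_detVec {G : Type*} [NormedAddCommGroup G] [NormedSpace ℝ G] {k : ℕ}
    {W : Fin k → G → RVec k} {W' : Fin k → G →L[ℝ] RVec k} {x : G}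
    (hW : ∀ i, HasFDerivAt (W i) (W' i) x) :
    ∃ D : G →L[ℝ] ℝ, HasFDerivAt (fun y => detVec fun i => W i y) D x ∧
      ∀ u, D u = ∑ i, detVec (Function.update (fun i => W i x) i (W' i u)) := by
  have hc : Continuous fun m : Fin k → RVec k => (Pi.basisFun ℝ (Fin k)).det m := by
    simp only [Pi.basisFun_det_apply]
    fun_prop
  let Φ : ContinuousMultilinearMap ℝ (fun _ : Fin k => RVec k) ℝ :=
    { (Pi.basisFun ℝ (Fin k)).det.toMultilinearMap with cont := hc }
  refine ⟨_, HasFDerivAt.multilinear_comp Φ hW, fun u => ?_⟩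
  simp only [sum_apply, ContinuousLinearMap.comp_apply,
    ContinuousMultilinearMap.toContinuousLinearMap_apply]
  rfl

theorem hasFDerivAt_detPair {G : Type*} [NormedAddCommGroup G] [NormedSpace ℝ G] {m : ℕ}
    {v : G → Fin m → RVec (m + 2)} {v' : Fin m → G →L[ℝ] RVec (m + 2)}
    {p q : G → RVec (m + 2)} {p' q' : G →L[ℝ] RVec (m + 2)} {x : G}
    (hv : ∀ i, HasFDerivAt (fun y => v y i) (v' i) x) (hp : HasFDerivAt p p' x)
    (hq : HasFDerivAt q q' x) :
    ∃ D : G →L[ℝ] ℝ, HasFDerivAt (fun y => detPair (v y) (p y) (q y)) D x ∧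
      ∀ u, D u = ∑ i, detPair (Function.update (v x) i (v' i u)) (p x) (q x)
        + detPair (v x) (p' u) (q x) + detPair (v x) (p x) (q' u) := by
  obtain ⟨D, hD, hD'⟩ := hasFDerivAt_detVec (x := x)
    (W := fun i y => Fin.snoc (α := fun _ => RVec (m + 2))
      (Fin.snoc (α := fun _ => RVec (m + 2)) (v y) (p y)) (q y) i)
    (W' := Fin.snoc (α := fun _ => G →L[ℝ] RVec (m + 2))
      (Fin.snoc (α := fun _ => G →L[ℝ] RVec (m + 2)) v' p') q') (by
      intro i
      refine Fin.lastCases ?_ (fun i => Fin.lastCases ?_ (fun i => ?_) i) i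
      · simpa using hq
      · simpa using hp
      · simpa using hv i)
  refine ⟨D, hD, fun u => ?_⟩
  rw [hD', Fin.sum_univ_castSucc, Fin.sum_univ_castSucc]
  simp only [Fin.snoc_castSucc, Fin.snoc_last, detPair]
  congr 1
  · congr 1
    · refine Finset.sum_congr rfl fun i _ => ?_
      rw [Fin.snoc_update, Fin.snoc_update]
    · rw [← Fin.snoc_update, Fin.update_snoc_last]
  · rw [Fin.update_snoc_last]

theorem differentiableAt_fderiv {m k : ℕ} {U : Set (RVec m)} (hU : IsOpen U)
    {F : RVec m → RVec k} (hF : ContDiffOn ℝ ∞ F U) {x : RVec m} (hx : x ∈ U) :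
    DifferentiableAt ℝ (fderiv ℝ F) x :=
  ((hF.contDiffAt (hU.mem_nhds hx)).fderiv_right (m := 1) (by norm_cast)).differentiableAt
    one_ne_zero

theorem differentiableAt_of_contDiffOn {m k : ℕ} {U : Set (RVec m)} (hU : IsOpen U)
    {F : RVec m → RVec k} (hF : ContDiffOn ℝ ∞ F U) {x : RVec m} (hx : x ∈ U) :
    DifferentiableAt ℝ F x :=
  (hF.contDiffAt (hU.mem_nhds hx)).differentiableAt (by norm_cast)

theorem hasFDerivAt_fderiv_apply {m k : ℕ} {F : RVec m → RVec k} {x : RVec m}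
    (h : DifferentiableAt ℝ (fderiv ℝ F) x) (v : RVec m) :
    HasFDerivAt (fun y => fderiv ℝ F y v) ((fderiv ℝ (fderiv ℝ F) x).flip v) x := by
  simpa using h.hasFDerivAt.clm_apply (hasFDerivAt_const v x)

theorem secondDeriv_eq {m k : ℕ} {F : RVec m → RVec k} {x : RVec m}
    (h : DifferentiableAt ℝ (fderiv ℝ F) x) (u v : RVec m) :
    secondDeriv F x u v = fderiv ℝ (fderiv ℝ F) x u v := by
  rw [secondDeriv, (hasFDerivAt_fderiv_apply h v).fderiv, ContinuousLinearMap.flip_apply]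

/-- The para-complex structure as a continuous linear map. -/
def paraJL (n : ℕ) : RVec (2 * n + 2) →L[ℝ] RVec (2 * n + 2) :=
  LinearMap.toContinuousLinearMap (paraJ n)

@[simp] theorem paraJL_apply (n : ℕ) (w : RVec (2 * n + 2)) : paraJL n w = paraJ n w := rfl

/-! ### The para-complex structure on the tangent spaces of g -/

section tangent

variable {n : ℕ} {V : Set (RVec (2 * n))} {g : RVec (2 * n) → RVec (2 * n + 2)}

/-- The para-complex structure induced on the tangent space. -/
theorem IsParaHolomorphicHypersurface.exists_tangentJ
    (hg : IsParaHolomorphicHypersurface V g) {x : RVec (2 * n)} (hx : x ∈ V) :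
    ∃ K : Module.End ℝ (RVec (2 * n)), (∀ v, fderiv ℝ g x (K v) = paraJ n (fderiv ℝ g x v)) ∧
      (∀ v, K (K v) = v) ∧ Module.finrank ℝ (Module.End.eigenspace K 1) = n ∧
      Module.finrank ℝ (Module.End.eigenspace K (-1)) = n := by
  have hinj : Function.Injective (fderiv ℝ g x).toLinearMap := hg.immersion x hx
  obtain ⟨L, hL⟩ := LinearMap.exists_leftInverse_of_injective _ (LinearMap.ker_eq_bot.2 hinj)
  have hL' : ∀ v, L (fderiv ℝ g x v) = v := fun v => LinearMap.congr_fun hL v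
  let K : Module.End ℝ (RVec (2 * n)) := L ∘ₗ paraJ n ∘ₗ (fderiv ℝ g x).toLinearMap
  have hK : ∀ v, fderiv ℝ g x (K v) = paraJ n (fderiv ℝ g x v) := by
    intro v
    obtain ⟨w, hw⟩ := hg.invariant x hx _ ⟨v, rfl⟩
    simp only [ContinuousLinearMap.coe_coe] at hw
    simp only [K, LinearMap.comp_apply, ContinuousLinearMap.coe_coe, ← hw, hL']
  have hKK : ∀ v, K (K v) = v := fun v => hinj (by
    simp only [ContinuousLinearMap.coe_coe, hK, paraJ_paraJ])
  have hE : ∀ c : ℝ, Module.finrank ℝ (Module.End.eigenspace K c) = Module.finrank ℝ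
      ↥(LinearMap.range (fderiv ℝ g x).toLinearMap ⊓ Module.End.eigenspace (paraJ n) c) := by
    intro c
    have h : (Module.End.eigenspace K c).map (fderiv ℝ g x).toLinearMap =
        LinearMap.range (fderiv ℝ g x).toLinearMap ⊓ Module.End.eigenspace (paraJ n) c := by
      ext w
      simp only [Submodule.mem_map, Submodule.mem_inf, LinearMap.mem_range,
        Module.End.mem_eigenspace_iff]
      constructor
      · rintro ⟨v, hv, rfl⟩
        refine ⟨⟨v, rfl⟩, ?_⟩
        rw [ContinuousLinearMap.coe_coe, ← hK, hv, map_smul]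
      · rintro ⟨⟨v, rfl⟩, hv⟩
        refine ⟨v, hinj ?_, rfl⟩
        rw [ContinuousLinearMap.coe_coe, hK, map_smul]
        exact hv
    rw [← h]
    exact (Submodule.equivMapOfInjective _ hinj _).finrank_eq
  have h12 : Module.finrank ℝ (Module.End.eigenspace K (-1)) =
      Module.finrank ℝ (Module.End.eigenspace K 1) := by
    rw [hE, hE, hg.paraComplex x hx]
  -- Only the dimension count is needed, so the coefficients 0, 0 are arbitrary.
  have hd := (det_add_smul_involution K hKK rfl h12 0 0).2
  simp only [Module.finrank_fintype_fun_eq_card, Fintype.card_fin] at hd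
  have hn : Module.finrank ℝ (Module.End.eigenspace K 1) = n := by omega
  exact ⟨K, hK, hKK, hn, h12.trans hn⟩

/-- `D_u g_*(JY)` and `J D_u g_*Y` have the same transversal part. -/
theorem IsParaHolomorphicHypersurface.secondDeriv_tangentJ
    (hg : IsParaHolomorphicHypersurface V g) {x : RVec (2 * n)} (hx : x ∈ V)
    {K : Module.End ℝ (RVec (2 * n))}
    (hK : ∀ v, fderiv ℝ g x (K v) = paraJ n (fderiv ℝ g x v)) (u v : RVec (2 * n)) :
    ∃ y, paraJ n (secondDeriv g x u v) = secondDeriv g x u (K v) + fderiv ℝ g x y := by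
  have hinj : Function.Injective (fderiv ℝ g x).toLinearMap := hg.immersion x hx
  have hd := differentiableAt_fderiv hg.isOpen hg.smooth hx
  obtain ⟨L₀, hL₀⟩ := LinearMap.exists_leftInverse_of_injective _ (LinearMap.ker_eq_bot.2 hinj)
  let L : RVec (2 * n + 2) →L[ℝ] RVec (2 * n) := LinearMap.toContinuousLinearMap L₀
  have hL : ∀ v, L (fderiv ℝ g x v) = v := fun v => LinearMap.congr_fun hL₀ v
  -- Here L inverts dg only at x, but L ∘ dg stays invertible nearby. Inverting it shows that the
  -- field Y with g_*Y = J g_*v is differentiable at x. Differentiating this identity then gives the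
  -- claim.
  let A : RVec (2 * n) → (RVec (2 * n) →L[ℝ] RVec (2 * n)) := fun y => L ∘SL fderiv ℝ g y
  have hA : DifferentiableAt ℝ A x := (differentiableAt_const L).clm_comp hd
  have hAx : A x = 1 := by ext1 v; exact hL v
  have hAi : DifferentiableAt ℝ (fun y => Ring.inverse (A y)) x :=
    DifferentiableAt.comp x (f := A) (g := Ring.inverse)
      (differentiableAt_inverse (hAx ▸ isUnit_one)) hA
  let Y : RVec (2 * n) → RVec (2 * n) :=
    fun y => Ring.inverse (A y) (L (paraJL n (fderiv ℝ g y v)))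
  have hv := hasFDerivAt_fderiv_apply hd v
  have hY : DifferentiableAt ℝ Y x :=
    hAi.clm_apply (L.differentiableAt.comp x
      ((paraJL n).differentiableAt.comp x hv.differentiableAt))
  have hYx : Y x = K v := by
    simp only [Y, hAx, Ring.inverse_one, paraJL_apply, ← hK, hL]
    rfl
  have hev : (fun y => paraJL n (fderiv ℝ g y v)) =ᶠ[nhds x] fun y => fderiv ℝ g y (Y y) := by
    have hu : ∀ᶠ y in nhds x, IsUnit (A y) :=
      hA.continuousAt.eventually (Units.isOpen.mem_nhds (hAx ▸ isUnit_one))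
    filter_upwards [hu, hg.isOpen.mem_nhds hx] with y hy hyV
    obtain ⟨w, hw⟩ := hg.invariant y hyV _ ⟨v, rfl⟩
    simp only [ContinuousLinearMap.coe_coe] at hw
    have : Y y = w := by
      simp only [Y, paraJL_apply, ← hw]
      exact congrArg (fun B : RVec (2 * n) →L[ℝ] RVec (2 * n) => B w)
        (Ring.inverse_mul_cancel (A y) hy)
    rw [paraJL_apply, this, hw]
  have h1 := ((paraJL n).hasFDerivAt.comp x hv)
  have h2 := (hd.hasFDerivAt.clm_apply hY.hasFDerivAt).congr_of_eventuallyEq hev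
  have h3 := congrArg (fun B => B u) (h1.unique h2)
  refine ⟨fderiv ℝ Y x u, ?_⟩
  simp only [ContinuousLinearMap.comp_apply, add_apply,
    ContinuousLinearMap.flip_apply, paraJL_apply, hYx] at h3
  rw [secondDeriv_eq hd, secondDeriv_eq hd]
  exact h3.trans (add_comm _ _)

end tangent

/-- The determinant of the matrix of a bilinear form in the standard basis. -/
def gramDet {m : ℕ} (h : LinearMap.BilinForm ℝ (RVec m)) : ℝ :=
  (Matrix.of fun i j => h (Pi.single i 1) (Pi.single j 1)).det

theorem gramDet_comp_right {m : ℕ} (h : LinearMap.BilinForm ℝ (RVec m))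
    (L : Module.End ℝ (RVec m)) :
    (Matrix.of fun i j => h (Pi.single i 1) (L (Pi.single j 1))).det
      = gramDet h * LinearMap.det L := by
  rw [gramDet, ← LinearMap.det_toMatrix', ← Matrix.det_mul]
  congr 1
  ext i j
  rw [Matrix.mul_apply, Matrix.of_apply]
  conv_lhs => rw [pi_eq_sum_univ' (L (Pi.single j 1))]
  simp [LinearMap.toMatrix'_apply, mul_comm]

/-- The normalisation of h₁ concerns unimodular bases only; passing to the coordinate basis costs
the square of its volume. -/
theorem abs_gramDet_eq_sq {n : ℕ} (hn : 1 ≤ n) {g ζ : RVec (2 * n) → RVec (2 * n + 2)}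
    {x : RVec (2 * n)} {h : LinearMap.BilinForm ℝ (RVec (2 * n))}
    (hD : detPair (frame g x) (ζ x) (paraJ n (ζ x)) ≠ 0)
    (hH : ∀ X : Fin (2 * n) → RVec (2 * n), paraVolume g ζ x X = 1 →
        |(Matrix.of fun i j => h (X i) (X j)).det| = 1) :
    |gramDet h| = detPair (frame g x) (ζ x) (paraJ n (ζ x)) ^ 2 := by
  set D := detPair (frame g x) (ζ x) (paraJ n (ζ x)) with hDdef
  -- Rescaling a single basis vector by D⁻¹ makes the basis unimodular; there is one because n ≥ 1.
  let i₀ : Fin (2 * n) := ⟨0, by omega⟩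
  let c : Fin (2 * n) → ℝ := Function.update 1 i₀ D⁻¹
  have hc : ∏ i, c i = D⁻¹ := by
    simp [c, Finset.prod_update_of_mem]
  let X : Fin (2 * n) → RVec (2 * n) := fun i => c i • Pi.single i 1
  have hX : paraVolume g ζ x X = 1 := by
    have h1 := (Pi.basisFun ℝ (Fin (2 * n + 2))).det.map_smul_univ
      (Fin.snoc (α := fun _ => ℝ) (Fin.snoc (α := fun _ => ℝ) c 1) 1)
      (Fin.snoc (α := fun _ => RVec (2 * n + 2))
        (Fin.snoc (α := fun _ => RVec (2 * n + 2)) (frame g x) (ζ x)) (paraJ n (ζ x)))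
    simp only [Fin.prod_univ_castSucc, Fin.snoc_castSucc, Fin.snoc_last, mul_one, hc] at h1
    have h2 : D⁻¹ • D = 1 := by rw [smul_eq_mul, inv_mul_cancel₀ hD]
    refine Eq.trans ?_ (h1.trans h2)
    rw [paraVolume, detVec]
    congr 1
    funext i
    refine Fin.lastCases ?_ (fun i => Fin.lastCases ?_ (fun i => ?_) i) i <;>
      simp [X, frame]
  have h1 := hH X hX
  have h2 : (Matrix.of fun i j => h (X i) (X j)) = Matrix.diagonal c *
      (Matrix.of fun i j => h (Pi.single i 1) (Pi.single j 1)) * Matrix.diagonal c := by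
    ext i j
    rw [Matrix.mul_diagonal, Matrix.diagonal_mul]
    simp only [Matrix.of_apply, X, map_smul, LinearMap.smul_apply, smul_eq_mul]
    ring
  rw [h2, Matrix.det_mul, Matrix.det_mul, Matrix.det_diagonal, hc, abs_mul, abs_mul] at h1
  have h3 : |D| ≠ 0 := abs_ne_zero.2 hD
  rw [abs_inv] at h1
  change |D|⁻¹ * |gramDet h| * |D|⁻¹ = 1 at h1
  field_simp at h1
  rw [h1, sq_abs]

/-! ### The derivative of the volume of a para-complex frame -/

section para

variable {n : ℕ} {V : Set (RVec (2 * n))} {g ζ : RVec (2 * n) → RVec (2 * n + 2)}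
    {Γ : RVec (2 * n) → RVec (2 * n) →ₗ[ℝ] RVec (2 * n) →ₗ[ℝ] RVec (2 * n)}
    {h₁ h₂ : RVec (2 * n) → LinearMap.BilinForm ℝ (RVec (2 * n))}
    {S : RVec (2 * n) → Module.End ℝ (RVec (2 * n))}
    {τ₁ τ₂ : RVec (2 * n) → Module.Dual ℝ (RVec (2 * n))}
    {x : RVec (2 * n)} {K : Module.End ℝ (RVec (2 * n))}

theorem IsParaTransversal.detPair_ne_zero (ht : IsParaTransversal V g ζ) (hx : x ∈ V) :
    detPair (frame g x) (ζ x) (paraJ n (ζ x)) ≠ 0 := by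
  apply AffineHypersphere.detPair_ne_zero
  intro w
  have hw : w ∈ LinearMap.range (fderiv ℝ g x).toLinearMap ⊔
      Submodule.span ℝ {ζ x, paraJ n (ζ x)} := by
    rw [(ht.transversal x hx).sup_eq_top]; trivial
  obtain ⟨_, ⟨y, rfl⟩, z, hz, rfl⟩ := Submodule.mem_sup.1 hw
  obtain ⟨a, b, rfl⟩ := Submodule.mem_span_pair.1 hz
  refine ⟨y, a, b, ?_⟩
  rw [ContinuousLinearMap.coe_coe, fderiv_eq_sum_frame]
  abel

/-- Compare the ζ-components of D_u g_*(Kv) and J D_u g_*v, which agree modulo tangent vectors. -/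
theorem IsParaInduced.h₂_eq (hi : IsParaInduced V g ζ Γ h₁ h₂ S τ₁ τ₂)
    (hg : IsParaHolomorphicHypersurface V g) (ht : IsParaTransversal V g ζ) (hx : x ∈ V)
    (hK : ∀ v, fderiv ℝ g x (K v) = paraJ n (fderiv ℝ g x v)) (u v : RVec (2 * n)) :
    h₂ x u v = h₁ x u (K v) := by
  obtain ⟨y, hy⟩ := hg.secondDeriv_tangentJ hx hK u v
  rw [hi.gauss x hx, hi.gauss x hx] at hy
  simp only [map_add, map_smul, paraJ_paraJ, ← hK] at hy
  have h : (h₂ x u v - h₁ x u (K v)) • ζ x + (h₁ x u v - h₂ x u (K v)) • paraJ n (ζ x)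
      = fderiv ℝ g x (Γ x u (K v) + y - K (Γ x u v)) := by
    rw [map_sub, map_add]
    linear_combination (norm := module) hy
  have := eq_zero_of_combination_mem_span (ht.detPair_ne_zero hx)
    (h ▸ fderiv_mem_span_frame g x _)
  linarith [this.1]

/-- The logarithmic derivative of `det[g_*e₁, …, g_*e_{2n}, η, Jη]` when `η` has tangential
derivatives. -/
theorem IsParaInduced.hasFDerivAt_detPair (hi : IsParaInduced V g ζ Γ h₁ h₂ S τ₁ τ₂)
    (hg : IsParaHolomorphicHypersurface V g) (ht : IsParaTransversal V g ζ) (hx : x ∈ V)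
    (hK : ∀ v, fderiv ℝ g x (K v) = paraJ n (fderiv ℝ g x v)) (hKK : ∀ v, K (K v) = v)
    {η : RVec (2 * n) → RVec (2 * n + 2)} (hη : DifferentiableAt ℝ η x)
    (hη' : ∀ u, ∃ y, fderiv ℝ η x u = fderiv ℝ g x y) {a b : ℝ} {Y : RVec (2 * n)}
    (hζ : ζ x = a • η x + b • paraJ n (η x) + fderiv ℝ g x Y) :
    ∃ D : RVec (2 * n) →L[ℝ] ℝ,
      HasFDerivAt (fun y => detPair (frame g y) (η y) (paraJ n (η y))) D x ∧
      ∀ u, D u = (LinearMap.trace ℝ _ (Γ x u) + 2 * h₁ x u Y) *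
        detPair (frame g x) (η x) (paraJ n (η x)) := by
  have hd := differentiableAt_fderiv hg.isOpen hg.smooth hx
  obtain ⟨D, hD, hD'⟩ := AffineHypersphere.hasFDerivAt_detPair (v := frame g)
    (fun i => hasFDerivAt_fderiv_apply hd (Pi.single i 1)) hη.hasFDerivAt
    ((paraJL n).hasFDerivAt.comp x hη.hasFDerivAt)
  refine ⟨D, hD, fun u => ?_⟩
  rw [hD']
  obtain ⟨y, hy⟩ := hη' u
  -- The derivatives of η and Jη are tangential, so only those of the frame vectors survive.
  have e1 : detPair (frame g x) (fderiv ℝ η x u) ((paraJL n ∘ η) x) = 0 :=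
    detPair_left_eq_zero _ _ (hy ▸ fderiv_mem_span_frame g x y)
  have e2 : detPair (frame g x) (η x) ((paraJL n ∘SL fderiv ℝ η x) u) = 0 := by
    refine detPair_right_eq_zero _ _ ?_
    rw [ContinuousLinearMap.comp_apply, paraJL_apply, hy, ← hK]
    exact fderiv_mem_span_frame g x _
  rw [e1, e2, add_zero, add_zero]
  have hJζ : paraJ n (ζ x) = b • η x + a • paraJ n (η x) + fderiv ℝ g x (K Y) := by
    rw [hζ]
    simp only [map_add, map_smul, paraJ_paraJ, hK]
    abel
  have key : ∀ i : Fin (2 * n), detPair (Function.update (frame g x) i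
      ((fderiv ℝ (fderiv ℝ g) x).flip (Pi.single i 1) u)) (η x) ((paraJL n ∘ η) x) =
      ((Γ x u (Pi.single i 1)) i + h₁ x u (Pi.single i 1) * Y i
        + h₁ x u (K (Pi.single i 1)) * K Y i) *
        detPair (frame g x) (η x) (paraJ n (η x)) := by
    intro i
    rw [ContinuousLinearMap.flip_apply, ← secondDeriv_eq hd, hi.gauss x hx,
      hi.h₂_eq hg ht hx hK, hJζ, hζ]
    set e : RVec (2 * n) := Pi.single i 1
    have : fderiv ℝ g x (Γ x u e) + h₁ x u e • (a • η x + b • paraJ n (η x) + fderiv ℝ g x Y)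
        + h₁ x u (K e) • (b • η x + a • paraJ n (η x) + fderiv ℝ g x (K Y)) =
        ∑ j, (Γ x u e + h₁ x u e • Y + h₁ x u (K e) • K Y) j • frame g x j
        + (h₁ x u e * a + h₁ x u (K e) * b) • η x
        + (h₁ x u e * b + h₁ x u (K e) * a) • paraJ n (η x) := by
      rw [← fderiv_eq_sum_frame, map_add, map_add, map_smul, map_smul]
      module
    rw [this]
    exact detPair_update (frame g x) (η x) (paraJ n (η x)) i _ _ _
  rw [Finset.sum_congr rfl fun i _ => key i, ← Finset.sum_mul]
  congr 1
  have t1 : LinearMap.trace ℝ _ (Γ x u) = ∑ i, Γ x u (Pi.single i 1) i := by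
    rw [LinearMap.trace_eq_matrix_trace ℝ (Pi.basisFun ℝ (Fin (2 * n))), Matrix.trace]
    simp
  have t2 : ∀ (ℓ : Module.Dual ℝ (RVec (2 * n))) (w : RVec (2 * n)),
      ∑ i, ℓ (Pi.single i 1) * w i = ℓ w := by
    intro ℓ w
    conv_rhs => rw [pi_eq_sum_univ' w]
    simp [mul_comm]
  rw [Finset.sum_add_distrib, Finset.sum_add_distrib, ← t1, t2 (h₁ x u)]
  -- The Jζ-term contributes h₁(u, K(KY)) = h₁(u, Y) once more, whence the factor 2.
  rw [show ∑ i, h₁ x u (K (Pi.single i 1)) * K Y i = h₁ x u (K (K Y)) from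
    t2 (h₁ x u ∘ₗ K) (K Y), hKK]
  ring

end para

/-! ### The normal field ζ is a multiple of the position vector -/

section para

variable {n : ℕ} {V : Set (RVec (2 * n))} {g ζ : RVec (2 * n) → RVec (2 * n + 2)}
    {Γ : RVec (2 * n) → RVec (2 * n) →ₗ[ℝ] RVec (2 * n) →ₗ[ℝ] RVec (2 * n)}
    {h₁ h₂ : RVec (2 * n) → LinearMap.BilinForm ℝ (RVec (2 * n))}
    {S : RVec (2 * n) → Module.End ℝ (RVec (2 * n))}
    {τ₁ τ₂ : RVec (2 * n) → Module.Dual ℝ (RVec (2 * n))}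
    {x : RVec (2 * n)} {K : Module.End ℝ (RVec (2 * n))} {α : ℝ}

/-- If `det[g_*e, ζ, Jζ]` and `det[g_*e, g, Jg]` have a constant quotient up to sign, then `ζ` has
no tangential part with respect to the transversal bundle spanned by `g` and `Jg`. -/
theorem IsParaInduced.exists_eq_combination (hi : IsParaInduced V g ζ Γ h₁ h₂ S τ₁ τ₂)
    (hg : IsParaHolomorphicHypersurface V g) (ht : IsParaTransversal V g ζ)
    (hnd : ∀ x ∈ V, (h₁ x).Nondegenerate)
    (hζ' : ∀ x ∈ V, ∀ u, fderiv ℝ ζ x u = -α • fderiv ℝ g x u)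
    (hD : ∀ x ∈ V, detPair (frame g x) (g x) (paraJ n (g x)) ≠ 0) {c : ℝ}
    (hc : ∀ x ∈ V, detPair (frame g x) (ζ x) (paraJ n (ζ x)) ^ 2 =
      c * detPair (frame g x) (g x) (paraJ n (g x)) ^ 2) (hx : x ∈ V) :
    ∃ a b : ℝ, ζ x = a • g x + b • paraJ n (g x) := by
  obtain ⟨K, hK, hKK, -, -⟩ := hg.exists_tangentJ hx
  obtain ⟨a, b, t, ht', hζ⟩ := exists_combination_of_detPair_ne_zero (hD x hx) (ζ x)
  rw [span_frame] at ht'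
  obtain ⟨Y, rfl⟩ := ht'
  refine ⟨a, b, ?_⟩
  -- The same formula is used for η = ζ, where Y = 0, and for η = g; both have tangential
  -- derivatives.
  obtain ⟨D₁, hD₁, hD₁'⟩ := hi.hasFDerivAt_detPair hg ht hx hK hKK
    (differentiableAt_of_contDiffOn hg.isOpen ht.smooth hx)
    (fun u => ⟨-α • u, by rw [hζ' x hx, map_smul]⟩) (a := 1) (b := 0) (Y := 0) (by simp)
  obtain ⟨D₂, hD₂, hD₂'⟩ := hi.hasFDerivAt_detPair hg ht hx hK hKK
    (differentiableAt_of_contDiffOn hg.isOpen hg.smooth hx) (fun u => ⟨u, rfl⟩) hζ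
  have hev : (fun y => detPair (frame g y) (ζ y) (paraJ n (ζ y)) ^ 2) =ᶠ[nhds x]
      fun y => c * detPair (frame g y) (g y) (paraJ n (g y)) ^ 2 := by
    filter_upwards [hg.isOpen.mem_nhds hx] with y hy using hc y hy
  have hu := (hD₁.pow 2).unique (((hD₂.pow 2).const_mul c).congr_of_eventuallyEq hev)
  have hY : ∀ u, h₁ x u Y = 0 := by
    intro u
    have h := congrArg (fun B => B u) hu
    simp only [smul_apply, hD₁', hD₂', smul_eq_mul, map_zero] at h
    have hne := pow_ne_zero 2 (ht.detPair_ne_zero hx)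
    have h2 : detPair (frame g x) (ζ x) (paraJ n (ζ x)) ^ 2 * h₁ x u Y = 0 := by
      have := hc x hx
      simp only [Nat.reduceSub, pow_one] at h
      linear_combination (-1 / 4 : ℝ) * h
        + (LinearMap.trace ℝ _ (Γ x u) / 2 + h₁ x u Y) * this
    simpa [hne] using h2
  have hY0 : Y = 0 := (hnd x hx).2 Y hY
  rw [hζ, hY0]
  simp

/-- If the constant vector d + εJd were nonzero, then g + εJg would stay on the line it spans. But
along a tangent vector v with Kv = εv the derivative of g + εJg is 2g_*v, which is nonzero and off
that line, because g and Jg are independent modulo the tangent space. -/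
theorem IsParaHolomorphicHypersurface.combination_eq_zero (hn : 1 ≤ n)
    (hg : IsParaHolomorphicHypersurface V g)
    (hD : ∀ x ∈ V, detPair (frame g x) (g x) (paraJ n (g x)) ≠ 0)
    {d : RVec (2 * n) → RVec (2 * n + 2)} {a b : RVec (2 * n) → ℝ}
    (hd : ∀ x ∈ V, d x = a x • g x + b x • paraJ n (g x))
    (hconst : ∀ᶠ y in nhds x, d y = d x) (hx : x ∈ V) {ε : ℝ} (hε : ε = 1 ∨ ε = -1) :
    d x + ε • paraJ n (d x) = 0 := by
  have hεε : ε * ε = 1 := by rcases hε with rfl | rfl <;> norm_num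
  by_contra hne
  obtain ⟨K, hK, -, hK1, hK2⟩ := hg.exists_tangentJ hx
  have hKε : Module.finrank ℝ (Module.End.eigenspace K ε) = n := by
    rcases hε with rfl | rfl
    exacts [hK1, hK2]
  have hnt : Module.End.eigenspace K ε ≠ ⊥ := by
    intro h
    rw [h, finrank_bot] at hKε
    omega
  obtain ⟨v, hv, hv0⟩ := Submodule.exists_mem_ne_zero_of_ne_bot hnt
  rw [Module.End.mem_eigenspace_iff] at hv
  have hJv : paraJ n (fderiv ℝ g x v) = ε • fderiv ℝ g x v := by rw [← hK, hv, map_smul]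
  have hw0 : fderiv ℝ g x v ≠ 0 := fun h =>
    hv0 (hg.immersion x hx (h.trans (map_zero _).symm))
  have hδ : ∀ y ∈ V, d y + ε • paraJ n (d y) =
      (a y + ε * b y) • (g y + ε • paraJ n (g y)) := by
    intro y hy
    rw [hd y hy]
    simp only [map_add, map_smul, paraJ_paraJ]
    linear_combination (norm := module) hεε • (-b y • paraJ n (g y))
  have hnot : fderiv ℝ g x v ∉ (ℝ ∙ (g x + ε • paraJ n (g x))) := by
    rw [Submodule.mem_span_singleton]
    rintro ⟨r, hr⟩
    have h : r • g x + (r * ε) • paraJ n (g x) = fderiv ℝ g x v := by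
      rw [← hr]; module
    have := eq_zero_of_combination_mem_span (hD x hx) (h ▸ fderiv_mem_span_frame g x v)
    rw [this.1, zero_smul] at hr
    exact hw0 hr.symm
  -- A functional vanishing on the line but not on g_*v detects the contradiction.
  obtain ⟨θ, hθ, hker⟩ := Submodule.exists_le_ker_of_notMem hnot
  have hθ0 : θ (g x + ε • paraJ n (g x)) = 0 := hker (Submodule.mem_span_singleton_self _)
  let Θ : RVec (2 * n + 2) →L[ℝ] ℝ := LinearMap.toContinuousLinearMap θ
  let H := Θ ∘SL (ContinuousLinearMap.id ℝ _ + ε • paraJL n)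
  have hH : ∀ w, H w = θ (w + ε • paraJ n w) := fun w => rfl
  have hev : (fun y => H (g y)) =ᶠ[nhds x] fun _ => 0 := by
    filter_upwards [hg.isOpen.mem_nhds hx, hconst] with y hy hdy
    have h := hδ y hy
    rw [hdy] at h
    have hr : a y + ε * b y ≠ 0 := fun h0 => hne (by rw [h, h0, zero_smul])
    have h1 : θ (d x + ε • paraJ n (d x)) = 0 := by rw [hδ x hx, map_smul, hθ0, smul_zero]
    rw [h, map_smul, smul_eq_mul, mul_eq_zero] at h1
    rw [hH]
    exact h1.resolve_left hr
  have hgx := (differentiableAt_of_contDiffOn hg.isOpen hg.smooth hx).hasFDerivAt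
  have h := congrArg (fun B => B v) ((H.hasFDerivAt.comp x hgx).unique
    ((hasFDerivAt_const (0 : ℝ) x).congr_of_eventuallyEq hev))
  simp only [ContinuousLinearMap.comp_apply, zero_apply, hH, hJv,
    smul_smul, hεε, one_smul, map_add] at h
  exact hθ (by linarith)

/-- The centre of a para-complex affine hypersphere whose transversal bundle is spanned by
`g` and `Jg` is the origin. -/
theorem IsParaHolomorphicHypersurface.eq_neg_smul (hn : 1 ≤ n)
    (hg : IsParaHolomorphicHypersurface V g) (hζs : ContDiffOn ℝ ∞ ζ V)
    (hζ' : ∀ x ∈ V, ∀ u, fderiv ℝ ζ x u = -α • fderiv ℝ g x u)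
    (hD : ∀ x ∈ V, detPair (frame g x) (g x) (paraJ n (g x)) ≠ 0)
    (h : ∀ x ∈ V, ∃ a b : ℝ, ζ x = a • g x + b • paraJ n (g x)) (hx : x ∈ V) :
    ζ x = -α • g x := by
  choose! a b hab using h
  let d : RVec (2 * n) → RVec (2 * n + 2) := fun y => ζ y + α • g y
  have hd : ∀ y ∈ V, HasFDerivAt d (0 : RVec (2 * n) →L[ℝ] RVec (2 * n + 2)) y := by
    intro y hy
    have h1 := (differentiableAt_of_contDiffOn hg.isOpen hζs hy).hasFDerivAt.add
      ((differentiableAt_of_contDiffOn hg.isOpen hg.smooth hy).hasFDerivAt.const_smul α)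
    have h0 : fderiv ℝ ζ y + α • fderiv ℝ g y = 0 := by
      ext1 u
      simp [hζ' y hy]
    exact h0 ▸ h1
  -- V need not be connected, so constancy is claimed only on a ball.
  have hconst : ∀ᶠ y in nhds x, d y = d x := by
    obtain ⟨r, hr, hball⟩ := Metric.isOpen_iff.1 hg.isOpen x hx
    filter_upwards [Metric.ball_mem_nhds x hr] with y hy
    exact Metric.isOpen_ball.is_const_of_fderiv_eq_zero (𝕜 := ℝ)
      (convex_ball x r).isPreconnected
      (fun z hz => (hd z (hball hz)).differentiableAt.differentiableWithinAt)
      (fun z hz => (hd z (hball hz)).fderiv) hy (Metric.mem_ball_self hr)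
  have hdc : ∀ y ∈ V, d y = (a y + α) • g y + b y • paraJ n (g y) := by
    intro y hy
    simp only [d]
    rw [hab y hy]
    module
  have e1 := hg.combination_eq_zero hn hD hdc hconst hx (Or.inl rfl)
  have e2 := hg.combination_eq_zero hn hD hdc hconst hx (Or.inr rfl)
  have e3 : d x = 0 := by linear_combination (norm := module) (1 / 2 : ℝ) • e1 + (1 / 2 : ℝ) • e2
  linear_combination (norm := module) e3

end para

/-! ### The hyperbolic rotations R_z and the derivatives of R_z g -/

/-- The map `w ↦ cosh z • J w - sinh z • w`. -/
def hypRot (n : ℕ) (z : ℝ) : Module.End ℝ (RVec (2 * n + 2)) :=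
  (-Real.sinh z) • LinearMap.id + Real.cosh z • paraJ n

theorem hypRot_apply (n : ℕ) (z : ℝ) (w : RVec (2 * n + 2)) :
    hypRot n z w = Real.cosh z • paraJ n w - Real.sinh z • w := by
  simp [hypRot, sub_eq_neg_add]

theorem paraJ_hypRot (n : ℕ) (z : ℝ) (w : RVec (2 * n + 2)) :
    paraJ n (hypRot n z w) = hypRot n z (paraJ n w) := by
  simp only [hypRot_apply, map_sub, map_smul]

theorem det_hypRot_sq (n : ℕ) (z : ℝ) : LinearMap.det (hypRot n z) ^ 2 = 1 := by
  rw [hypRot, det_add_smul_paraJ_sq, neg_sq, Real.cosh_sq]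
  have : Real.sinh z ^ 2 - (Real.sinh z ^ 2 + 1) = -1 := by ring
  rw [this]
  exact Even.neg_one_pow ⟨n + 1, by ring⟩

/-- The coefficients of R_z satisfy (-sinh z)² - cosh² z = -1. -/
theorem detPair_hypRot (n : ℕ) (z : ℝ) (v : Fin (2 * n) → RVec (2 * n + 2))
    (p : RVec (2 * n + 2)) :
    detPair v (hypRot n z p) (paraJ n (hypRot n z p)) = -detPair v p (paraJ n p) := by
  have h := detPair_combination v (p := p) (q := paraJ n p) (-Real.sinh z) (Real.cosh z)
    (zero_mem _) (zero_mem _)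
  rw [neg_sq, Real.cosh_sq, sub_add_cancel_left, neg_one_mul] at h
  rw [← h, paraJ_hypRot, hypRot_apply, hypRot_apply, paraJ_paraJ]
  congr 1 <;> module

/-- The projection to the first `m` coordinates. -/
def initL (m : ℕ) : RVec (m + 1) →L[ℝ] RVec m :=
  ContinuousLinearMap.pi fun i => ContinuousLinearMap.proj i.castSucc

theorem initL_apply (m : ℕ) (p : RVec (m + 1)) :
    initL m p = Fin.init (α := fun _ => ℝ) p := rfl

/-- The last term comes from ∂_z R_z = -J R_z. -/
theorem hasFDerivAt_hypRot {n : ℕ} {G : RVec (2 * n) → RVec (2 * n + 2)}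
    {G' : RVec (2 * n) →L[ℝ] RVec (2 * n + 2)} {p : RVec (2 * n + 1)}
    (hG : HasFDerivAt G G' (initL (2 * n) p)) :
    ∃ D : RVec (2 * n + 1) →L[ℝ] RVec (2 * n + 2),
      HasFDerivAt (fun q => hypRot n (q (Fin.last _)) (G (initL (2 * n) q))) D p ∧
      ∀ u, D u = hypRot n (p (Fin.last _)) (G' (initL (2 * n) u))
        - u (Fin.last _) • paraJ n (hypRot n (p (Fin.last _)) (G (initL (2 * n) p))) := by
  have hl : HasFDerivAt (fun q : RVec (2 * n + 1) => q (Fin.last (2 * n)))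
      (ContinuousLinearMap.proj (R := ℝ) (φ := fun _ => ℝ) (Fin.last (2 * n))) p :=
    (ContinuousLinearMap.proj (R := ℝ) (φ := fun _ => ℝ) (Fin.last (2 * n))).hasFDerivAt
  have hGi := HasFDerivAt.comp p hG (initL (2 * n)).hasFDerivAt
  have h := (hl.cosh.smul ((paraJL n).hasFDerivAt.comp p hGi)).sub (hl.sinh.smul hGi)
  refine ⟨_, h.congr_of_eventuallyEq (Filter.Eventually.of_forall fun q => ?_), fun u => ?_⟩
  · simp [hypRot_apply]
  · simp only [sub_apply, add_apply, smul_apply, ContinuousLinearMap.comp_apply,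
      Function.comp_apply, ContinuousLinearMap.smulRight_apply, ContinuousLinearMap.proj_apply,
      paraJL_apply, hypRot_apply, map_sub, map_smul, paraJ_paraJ, smul_eq_mul]
    module

section expression

variable {n : ℕ} {V : Set (RVec (2 * n))} {I : Set ℝ} {g : RVec (2 * n) → RVec (2 * n + 2)}
    {F : RVec (2 * n + 1) → RVec (2 * n + 2)} {U : Set (RVec (2 * n + 1))} {p : RVec (2 * n + 1)}

theorem fderiv_of_eq_hypRot (hg : IsParaHolomorphicHypersurface V g) (hU : IsOpen U)
    (hUV : ∀ p ∈ U, initL (2 * n) p ∈ V)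
    (hF : ∀ p ∈ U, F p = hypRot n (p (Fin.last _)) (g (initL (2 * n) p))) (hp : p ∈ U)
    (u : RVec (2 * n + 1)) :
    fderiv ℝ F p u =
      hypRot n (p (Fin.last _)) (fderiv ℝ g (initL (2 * n) p) (initL (2 * n) u))
        - u (Fin.last _) • paraJ n (F p) := by
  obtain ⟨D, hD, hD'⟩ := hasFDerivAt_hypRot
    (differentiableAt_of_contDiffOn hg.isOpen hg.smooth (hUV p hp)).hasFDerivAt
  have hev : F =ᶠ[nhds p] fun q => hypRot n (q (Fin.last _)) (g (initL (2 * n) q)) := by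
    filter_upwards [hU.mem_nhds hp] with q hq using hF q hq
  rw [(hD.congr_of_eventuallyEq hev).fderiv, hD', ← hF p hp]

theorem secondDeriv_of_eq_hypRot (hg : IsParaHolomorphicHypersurface V g) (hU : IsOpen U)
    (hUV : ∀ p ∈ U, initL (2 * n) p ∈ V)
    (hF : ∀ p ∈ U, F p = hypRot n (p (Fin.last _)) (g (initL (2 * n) p))) (hp : p ∈ U)
    (u v : RVec (2 * n + 1)) :
    secondDeriv F p u v = hypRot n (p (Fin.last _))
        (secondDeriv g (initL (2 * n) p) (initL (2 * n) u) (initL (2 * n) v)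
          - u (Fin.last _) • paraJ n (fderiv ℝ g (initL (2 * n) p) (initL (2 * n) v))
          - v (Fin.last _) • paraJ n (fderiv ℝ g (initL (2 * n) p) (initL (2 * n) u)))
        + (u (Fin.last _) * v (Fin.last _)) • F p := by
  have hd := differentiableAt_fderiv hg.isOpen hg.smooth (hUV p hp)
  obtain ⟨D, hD, hD'⟩ := hasFDerivAt_hypRot (hasFDerivAt_fderiv_apply hd (initL (2 * n) v))
  obtain ⟨E, hE, hE'⟩ := hasFDerivAt_hypRot
    (differentiableAt_of_contDiffOn hg.isOpen hg.smooth (hUV p hp)).hasFDerivAt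
  have h := hD.sub (((paraJL n).hasFDerivAt.comp p hE).const_smul (v (Fin.last _)))
  have hev : (fun q => fderiv ℝ F q v) =ᶠ[nhds p] fun q =>
      hypRot n (q (Fin.last _)) (fderiv ℝ g (initL (2 * n) q) (initL (2 * n) v))
        - v (Fin.last _) • paraJL n (hypRot n (q (Fin.last _)) (g (initL (2 * n) q))) := by
    filter_upwards [hU.mem_nhds hp] with q hq
    rw [fderiv_of_eq_hypRot hg hU hUV hF hq, paraJL_apply, ← hF q hq]
  rw [secondDeriv, (h.congr_of_eventuallyEq hev).fderiv]
  simp only [sub_apply, smul_apply, ContinuousLinearMap.comp_apply, hD', hE', paraJL_apply,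
    ContinuousLinearMap.flip_apply, ← secondDeriv_eq hd, ← hF p hp, map_sub, map_smul,
    paraJ_paraJ, paraJ_hypRot]
  module

end expression

/-- `detPair` as a linear functional of its first distinguished argument. -/
def detPairL {m : ℕ} (v : Fin m → RVec (m + 2)) (q : RVec (m + 2)) : RVec (m + 2) →L[ℝ] ℝ :=
  LinearMap.toContinuousLinearMap
    { toFun := fun p => detPair v p q
      map_add' := fun p p' => detPair_add_left v p p' q
      map_smul' := fun c p => detPair_smul_left v p q c }

@[simp] theorem detPairL_apply {m : ℕ} (v : Fin m → RVec (m + 2)) (p q : RVec (m + 2)) :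
    detPairL v q p = detPair v p q := rfl

theorem det_eq_of_castSucc_block {m : ℕ} (M : Matrix (Fin (m + 1)) (Fin (m + 1)) ℝ)
    (A : Matrix (Fin m) (Fin m) ℝ) (h1 : ∀ i j : Fin m, M i.castSucc j.castSucc = A i j)
    (h2 : ∀ i : Fin m, M i.castSucc (Fin.last m) = 0)
    (h3 : ∀ i : Fin m, M (Fin.last m) i.castSucc = 0) (h4 : M (Fin.last m) (Fin.last m) = 1) :
    M.det = A.det := by
  have h : M.submatrix (finSumFinEquiv (m := m) (n := 1)) (finSumFinEquiv (m := m) (n := 1))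
      = Matrix.fromBlocks A 0 0 1 := by
    have e0 : Fin.natAdd m (0 : Fin 1) = Fin.last m := rfl
    ext i j
    rcases i with i | i <;> rcases j with j | j
    · exact h1 i j
    · obtain rfl := Subsingleton.elim j 0
      exact h2 i
    · obtain rfl := Subsingleton.elim i 0
      exact h3 j
    · obtain rfl := Subsingleton.elim i 0
      obtain rfl := Subsingleton.elim j 0
      simpa [e0] using h4
  rw [← Matrix.det_submatrix_equiv_self (finSumFinEquiv (m := m) (n := 1)) M, h,
    Matrix.det_fromBlocks_zero₂₁, Matrix.det_one, mul_one]

/-! ### The Blaschke field of f and its Weingarten formula -/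

section expression

variable {n : ℕ} {V : Set (RVec (2 * n))} {g : RVec (2 * n) → RVec (2 * n + 2)}
    {F C : RVec (2 * n + 1) → RVec (2 * n + 2)} {U : Set (RVec (2 * n + 1))}
    {p : RVec (2 * n + 1)}

theorem IsParaHolomorphicHypersurface.hypRot_mem (hg : IsParaHolomorphicHypersurface V g)
    {x : RVec (2 * n)} (hx : x ∈ V) (z : ℝ) {w : RVec (2 * n + 2)}
    (hw : w ∈ Submodule.span ℝ (Set.range (frame g x))) :
    hypRot n z w ∈ Submodule.span ℝ (Set.range (frame g x)) := by
  rw [span_frame] at hw ⊢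
  rw [hypRot_apply]
  exact sub_mem (Submodule.smul_mem _ _ (hg.invariant x hx _ hw)) (Submodule.smul_mem _ _ hw)

/-- The form of a `J`-tangent transversal field along `cosh z • J g - sinh z • g`. -/
theorem exists_field_eq_hypRot (hg : IsParaHolomorphicHypersurface V g)
    (hUV : ∀ p ∈ U, initL (2 * n) p ∈ V)
    (hF : ∀ p ∈ U, F p = hypRot n (p (Fin.last _)) (g (initL (2 * n) p)))
    (ht : IsTransversalPair U F C)
    (hJ : ∀ p ∈ U, paraJ n (C p) ∈ LinearMap.range (fderiv ℝ F p).toLinearMap) (hp : p ∈ U) :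
    detPair (frame g (initL (2 * n) p)) (g (initL (2 * n) p))
        (paraJ n (g (initL (2 * n) p))) ≠ 0 ∧
      ∃ s : ℝ, s ≠ 0 ∧ ∃ y, C p = hypRot n (p (Fin.last _))
        (fderiv ℝ g (initL (2 * n) p) y + s • g (initL (2 * n) p)) := by
  have hx := hUV p hp
  set x := initL (2 * n) p with hxdef
  set z := p (Fin.last _) with hz
  obtain ⟨K, hK, -, -, -⟩ := hg.exists_tangentJ hx
  obtain ⟨v, hv⟩ := hJ p hp
  have hfd : ∀ u, fderiv ℝ F p u = hypRot n z (fderiv ℝ g x (initL (2 * n) u))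
      - u (Fin.last _) • paraJ n (F p) :=
    fderiv_of_eq_hypRot hg ht.isOpen hUV hF hp
  -- Apply J to JC = f_*v and use J² = 1; the coefficient s is minus the last coordinate of v.
  have hC : C p = hypRot n z (fderiv ℝ g x (K (initL (2 * n) v))
      + (-v (Fin.last _)) • g x) := by
    rw [← paraJ_paraJ n (C p), ← hv, ContinuousLinearMap.coe_coe, hfd, map_sub, map_smul,
      paraJ_paraJ, paraJ_hypRot, hK, hF p hp, map_add, map_smul]
    module
  have hspan : ∀ w, ∃ y, ∃ c d : ℝ, w = fderiv ℝ g x y + c • paraJ n (F p) + d • C p := by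
    intro w
    have hw : w ∈ LinearMap.range (fderiv ℝ F p).toLinearMap ⊔ (ℝ ∙ C p) := by
      rw [(ht.transversal p hp).sup_eq_top]; trivial
    obtain ⟨_, ⟨u, rfl⟩, c, hc, rfl⟩ := Submodule.mem_sup.1 hw
    obtain ⟨d, rfl⟩ := Submodule.mem_span_singleton.1 hc
    have hmem := hg.hypRot_mem hx z (fderiv_mem_span_frame g x (initL (2 * n) u))
    rw [span_frame] at hmem
    obtain ⟨y, hy⟩ := hmem
    refine ⟨y, -u (Fin.last _), d, ?_⟩
    rw [ContinuousLinearMap.coe_coe] at hy ⊢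
    rw [hfd, hy]
    module
  have hD1 : detPair (frame g x) (paraJ n (F p)) (C p) ≠ 0 := by
    apply detPair_ne_zero
    intro w
    obtain ⟨y, c, d, h⟩ := hspan w
    exact ⟨y, c, d, by rw [h, fderiv_eq_sum_frame]⟩
  -- The determinant of the transversal frame factors as s · det[g_*e, g, Jg], so both factors are
  -- nonzero.
  have hD2 : detPair (frame g x) (paraJ n (F p)) (C p)
      = -v (Fin.last _) * detPair (frame g x) (g x) (paraJ n (g x)) := by
    rw [hC, map_add, detPair_add_right, detPair_right_eq_zero _ _
      (hg.hypRot_mem hx z (fderiv_mem_span_frame g x _)), zero_add, map_smul,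
      detPair_smul_right, hF p hp, detPair_swap, detPair_hypRot, neg_neg]
  rw [hD2] at hD1
  exact ⟨right_ne_zero_of_mul hD1, _, left_ne_zero_of_mul hD1, _, hC⟩

/-- For a `J`-tangent field with shape operator `lam • id` the coefficient is `-lam`. -/
theorem coefficient_eq_neg_of_weingarten (hg : IsParaHolomorphicHypersurface V g)
    (hUV : ∀ p ∈ U, initL (2 * n) p ∈ V)
    (hF : ∀ p ∈ U, F p = hypRot n (p (Fin.last _)) (g (initL (2 * n) p)))
    (ht : IsTransversalPair U F C)
    (hJ : ∀ p ∈ U, paraJ n (C p) ∈ LinearMap.range (fderiv ℝ F p).toLinearMap) (hp : p ∈ U)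
    {lam t s : ℝ} (hw : fderiv ℝ C p (Pi.single (Fin.last _) 1) =
      -(lam • fderiv ℝ F p (Pi.single (Fin.last _) 1)) + t • C p) {y : RVec (2 * n)}
    (hC : C p = hypRot n (p (Fin.last _))
        (fderiv ℝ g (initL (2 * n) p) y + s • g (initL (2 * n) p))) :
    s = -lam := by
  have hx := hUV p hp
  set x := initL (2 * n) p with hxdef
  set z := p (Fin.last _) with hz
  set e : RVec (2 * n + 1) := Pi.single (Fin.last _) 1 with he
  have hie : initL (2 * n) e = 0 := by
    funext i
    simp [initL, he, (Fin.castSucc_lt_last i).ne]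
  have hel : e (Fin.last _) = 1 := by simp [he]
  set D := detPair (frame g x) (g x) (paraJ n (g x)) with hD
  have hD0 : D ≠ 0 := (exists_field_eq_hypRot hg hUV hF ht hJ hp).1
  -- Up to the factors D and -D, φ and ψ read off the g- and Jg-components modulo the tangent space
  -- of g.
  set φ := detPairL (frame g x) (paraJ n (g x)) with hφ
  set ψ := detPairL (frame g x) (g x) with hψ
  have hval : ∀ (r c : ℝ) (y : RVec (2 * n)),
      φ (hypRot n r (fderiv ℝ g x y + c • g x)) = -(c * Real.sinh r * D) ∧
      ψ (hypRot n r (fderiv ℝ g x y + c • g x)) = -(c * Real.cosh r * D) := by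
    intro r c y
    have hm := hg.hypRot_mem hx r (fderiv_mem_span_frame g x y)
    constructor
    · rw [map_add, map_add, hφ, detPairL_apply, detPair_left_eq_zero _ _ hm, map_smul, map_smul,
        hypRot_apply, map_sub, map_smul, map_smul, detPairL_apply, detPairL_apply, detPair_self]
      simp only [smul_eq_mul, ← hD]
      ring
    · rw [map_add, map_add, hψ, detPairL_apply, detPair_left_eq_zero _ _ hm, map_smul, map_smul,
        hypRot_apply, map_sub, map_smul, map_smul, detPairL_apply, detPairL_apply, detPair_self,
        detPair_swap]
      simp only [smul_eq_mul, ← hD]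
      ring
  let γ : ℝ → RVec (2 * n + 1) := fun r => p + r • e
  have hγ : HasDerivAt γ e 0 := by
    have h := ((hasDerivAt_id (0 : ℝ)).smul_const e).const_add p
    rw [one_smul] at h
    exact h
  have hγ0 : γ 0 = p := by simp [γ]
  have hγl : ∀ r, γ r (Fin.last _) = z + r := fun r => by simp [γ, hel, hz]
  have hγi : ∀ r, initL (2 * n) (γ r) = x := fun r => by simp [γ, hie, hxdef]
  have hCd : HasDerivAt (fun r => C (γ r)) (fderiv ℝ C p e) 0 :=
    HasFDerivAt.comp_hasDerivAt (0 : ℝ)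
      (by rw [hγ0]; exact (differentiableAt_of_contDiffOn ht.isOpen ht.smooth_field hp).hasFDerivAt)
      hγ
  have hzd : HasDerivAt (fun r => z + r) 1 (0 : ℝ) := (hasDerivAt_id (0 : ℝ)).const_add z
  -- Modulo the tangent space of g, C stays proportional to R_{z+r} g along the z-line, so cosh ·
  -- φ(C) - sinh · ψ(C) vanishes identically. Differentiating this relation at r = 0 avoids
  -- differentiating the coefficient s.
  have hΦ := (hzd.cosh.mul (φ.hasFDerivAt.comp_hasDerivAt (0 : ℝ) hCd)).sub
    (hzd.sinh.mul (ψ.hasFDerivAt.comp_hasDerivAt (0 : ℝ) hCd))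
  have hev : ∀ᶠ r in nhds (0 : ℝ),
      Real.cosh (z + r) * φ (C (γ r)) - Real.sinh (z + r) * ψ (C (γ r)) = 0 := by
    have hU : ∀ᶠ r in nhds (0 : ℝ), γ r ∈ U :=
      hγ.continuousAt.eventually (ht.isOpen.mem_nhds (by rw [hγ0]; exact hp))
    filter_upwards [hU] with r hr
    obtain ⟨-, s', -, y', h⟩ := exists_field_eq_hypRot hg hUV hF ht hJ hr
    rw [hγl, hγi] at h
    rw [h, (hval _ _ _).1, (hval _ _ _).2]
    ring
  have h0 := hΦ.unique ((hasDerivAt_const (0 : ℝ) (0 : ℝ)).congr_of_eventuallyEq hev)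
  have hFe : fderiv ℝ F p e = -paraJ n (F p) := by
    rw [fderiv_of_eq_hypRot hg ht.isOpen hUV hF hp, hie, hel]
    simp
  have hJF : paraJ n (F p) = Real.cosh z • g x - Real.sinh z • paraJ n (g x) := by
    rw [hF p hp, paraJ_hypRot, hypRot_apply, paraJ_paraJ]
  have e1 : φ (fderiv ℝ C p e) = lam * Real.cosh z * D - t * (s * Real.sinh z * D) := by
    rw [hw, hFe, hJF, map_add, map_smul, hC, (hval _ _ _).1]
    simp only [smul_neg, neg_neg, map_smul, map_sub, hφ, detPairL_apply, detPair_self,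
      smul_eq_mul, ← hD]
    ring
  have e2 : ψ (fderiv ℝ C p e) = lam * Real.sinh z * D - t * (s * Real.cosh z * D) := by
    rw [hw, hFe, hJF, map_add, map_smul, hC, (hval _ _ _).2]
    simp only [smul_neg, neg_neg, map_smul, map_sub, hψ, detPairL_apply, detPair_self,
      smul_eq_mul, detPair_swap _ (g x), ← hD]
    ring
  simp only [Function.comp_apply, hγ0, add_zero, e1, e2, hC, (hval _ _ _).1, (hval _ _ _).2,
    mul_one] at h0
  -- The τ-terms cancel, being multiples of C.
  have h1 : (s + lam) * D = 0 := by
    linear_combination h0 - (s + lam) * D * Real.cosh_sq z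
  linarith [(mul_eq_zero.1 h1).resolve_right hD0]

end expression

/-- The standard basis of `ℝᵐ⁺¹`, adapted to the splitting `ℝᵐ × ℝ`. -/
def productBasis (m : ℕ) : Fin (m + 1) → RVec (m + 1) :=
  Fin.snoc (α := fun _ => RVec (m + 1))
    (fun i => Fin.snoc (α := fun _ => ℝ) (Pi.single i 1 : RVec m) 0)
    (Fin.snoc (α := fun _ => ℝ) (0 : RVec m) 1)

theorem initL_productBasis_castSucc {m : ℕ} (i : Fin m) :
    initL m (productBasis m i.castSucc) = Pi.single i 1 := by
  simp [productBasis, initL_apply]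

theorem initL_productBasis_last (m : ℕ) : initL m (productBasis m (Fin.last m)) = 0 := by
  simp [productBasis, initL_apply]

theorem productBasis_castSucc_last {m : ℕ} (i : Fin m) :
    productBasis m i.castSucc (Fin.last m) = 0 := by
  simp [productBasis]

theorem productBasis_last_last (m : ℕ) : productBasis m (Fin.last m) (Fin.last m) = 1 := by
  simp [productBasis]

/-- Squaring removes the orientation sign. -/
theorem abs_det_eq_sq_of_metricVolume_eq {m : ℕ} {Θ : RVec m → (Fin m → RVec m) → ℝ}
    {h : RVec m → LinearMap.BilinForm ℝ (RVec m)} {x : RVec m} {X : Fin m → RVec m}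
    (hΘ : metricVolume Θ h x X = Θ x X) (h0 : Θ x X ≠ 0) :
    |(Matrix.of fun i j => h x (X i) (X j)).det| = Θ x X ^ 2 := by
  have hs : Real.sign (Θ x X) ^ 2 = 1 := by
    rcases Real.sign_apply_eq_of_ne_zero _ h0 with h | h <;> rw [h] <;> norm_num
  rw [metricVolume] at hΘ
  have h2 := congrArg (fun r => r ^ 2) hΘ
  simp only [mul_pow, hs, one_mul] at h2
  rwa [Real.sq_sqrt (abs_nonneg _)] at h2

/-! ### Volume and affine metric of f in terms of g -/

section expression

variable {n : ℕ} {V : Set (RVec (2 * n))} {g ζ : RVec (2 * n) → RVec (2 * n + 2)}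
    {Γ : RVec (2 * n) → RVec (2 * n) →ₗ[ℝ] RVec (2 * n) →ₗ[ℝ] RVec (2 * n)}
    {h₁ h₂ : RVec (2 * n) → LinearMap.BilinForm ℝ (RVec (2 * n))}
    {S : RVec (2 * n) → Module.End ℝ (RVec (2 * n))}
    {τ₁ τ₂ : RVec (2 * n) → Module.Dual ℝ (RVec (2 * n))}
    {F C : RVec (2 * n + 1) → RVec (2 * n + 2)} {U : Set (RVec (2 * n + 1))}
    {Γ' : RVec (2 * n + 1) → RVec (2 * n + 1) →ₗ[ℝ] RVec (2 * n + 1) →ₗ[ℝ] RVec (2 * n + 1)}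
    {h : RVec (2 * n + 1) → LinearMap.BilinForm ℝ (RVec (2 * n + 1))}
    {S' : RVec (2 * n + 1) → Module.End ℝ (RVec (2 * n + 1))}
    {τ : RVec (2 * n + 1) → Module.Dual ℝ (RVec (2 * n + 1))}
    {p : RVec (2 * n + 1)}

/-- All columns are images under R_z, since ∂_z f = R_z(-Jg), and (det R_z)² = 1. -/
theorem inducedVolume_sq_of_eq_hypRot (hg : IsParaHolomorphicHypersurface V g)
    (hU : IsOpen U) (hUV : ∀ p ∈ U, initL (2 * n) p ∈ V)
    (hF : ∀ p ∈ U, F p = hypRot n (p (Fin.last _)) (g (initL (2 * n) p))) (hp : p ∈ U)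
    {s : ℝ} {y : RVec (2 * n)} (hC : C p = hypRot n (p (Fin.last _))
        (fderiv ℝ g (initL (2 * n) p) y + s • g (initL (2 * n) p))) :
    inducedVolume F C p (productBasis (2 * n)) ^ 2 =
      s ^ 2 * detPair (frame g (initL (2 * n) p)) (g (initL (2 * n) p))
        (paraJ n (g (initL (2 * n) p))) ^ 2 := by
  have hfd := fderiv_of_eq_hypRot hg hU hUV hF hp
  set x := initL (2 * n) p with hxdef
  set z := p (Fin.last _) with hz
  have h1 : inducedVolume F C p (productBasis (2 * n)) =
      detPair (fun i => hypRot n z (frame g x i)) (hypRot n z (-paraJ n (g x)))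
        (hypRot n z (fderiv ℝ g x y + s • g x)) := by
    rw [inducedVolume, detPair, hC]
    congr 2
    funext i
    rw [hfd]
    refine Fin.lastCases ?_ (fun i => ?_) i
    · rw [initL_productBasis_last, productBasis_last_last, hF p hp, Fin.snoc_last, paraJ_hypRot,
        map_zero, map_zero, map_neg, one_smul, zero_sub]
    · rw [initL_productBasis_castSucc, productBasis_castSucc_last, Fin.snoc_castSucc, zero_smul,
        sub_zero, frame]
  rw [h1, detPair_map, detPair_add_right,
    detPair_right_eq_zero _ _ (fderiv_mem_span_frame g x y), zero_add, detPair_smul_right,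
    ← neg_one_smul ℝ (paraJ n (g x)), detPair_smul_left, detPair_swap, mul_pow, det_hypRot_sq]
  ring

/-- The affine metric of `cosh z • J g - sinh z • g` in terms of that of `g`. -/
theorem metric_of_eq_hypRot (hg : IsParaHolomorphicHypersurface V g)
    (htg : IsParaTransversal V g ζ) (hig : IsParaInduced V g ζ Γ h₁ h₂ S τ₁ τ₂)
    (hU : IsOpen U) (hUV : ∀ p ∈ U, initL (2 * n) p ∈ V)
    (hF : ∀ p ∈ U, F p = hypRot n (p (Fin.last _)) (g (initL (2 * n) p))) (hp : p ∈ U)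
    (hi : IsInduced U F C Γ' h S' τ)
    (hD : detPair (frame g (initL (2 * n) p)) (g (initL (2 * n) p))
        (paraJ n (g (initL (2 * n) p))) ≠ 0)
    {s : ℝ} {y : RVec (2 * n)} (hC : C p = hypRot n (p (Fin.last _))
        (fderiv ℝ g (initL (2 * n) p) y + s • g (initL (2 * n) p)))
    {K : Module.End ℝ (RVec (2 * n))}
    (hK : ∀ v, fderiv ℝ g (initL (2 * n) p) (K v) = paraJ n (fderiv ℝ g (initL (2 * n) p) v))
    {a b : ℝ} {Y : RVec (2 * n)} (hζ : ζ (initL (2 * n) p) = a • g (initL (2 * n) p)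
      + b • paraJ n (g (initL (2 * n) p)) + fderiv ℝ g (initL (2 * n) p) Y)
    (u v : RVec (2 * n + 1)) :
    s * h p u v = h₁ (initL (2 * n) p) (initL (2 * n) u)
        ((a • LinearMap.id + b • K : Module.End ℝ _) (initL (2 * n) v))
      + u (Fin.last _) * v (Fin.last _) := by
  have hx := hUV p hp
  have hfd := fderiv_of_eq_hypRot hg hU hUV hF hp
  have hsd := secondDeriv_of_eq_hypRot hg hU hUV hF hp u v
  rw [hi.gauss p hp, hfd] at hsd
  set x := initL (2 * n) p with hxdef
  set z := p (Fin.last _) with hz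
  set D := detPair (frame g x) (g x) (paraJ n (g x)) with hDdef
  set u₀ := initL (2 * n) u
  set v₀ := initL (2 * n) v
  rw [hig.gauss x hx, hig.h₂_eq hg htg hx hK] at hsd
  have hJζ : paraJ n (ζ x) = b • g x + a • paraJ n (g x) + fderiv ℝ g x (K Y) := by
    rw [hζ]
    simp only [map_add, map_smul, paraJ_paraJ, hK]
    abel
  rw [hJζ, hζ] at hsd
  -- The functional det[g_*e, ·, JF] kills the tangent space of g and JF. It takes the value -D on F
  -- and -sD on C, so applied to the Gauss formula it isolates s h.
  have hT : ∀ w, detPairL (frame g x) (paraJ n (F p)) (hypRot n z (fderiv ℝ g x w)) = 0 :=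
    fun w => detPair_left_eq_zero _ _ (hg.hypRot_mem hx z (fderiv_mem_span_frame g x w))
  have hP : detPairL (frame g x) (paraJ n (F p)) (hypRot n z (g x)) = -D := by
    rw [detPairL_apply, hF p hp, detPair_hypRot]
  have hPJ : detPairL (frame g x) (paraJ n (F p)) (hypRot n z (paraJ n (g x))) = 0 := by
    rw [detPairL_apply, hF p hp, ← paraJ_hypRot, detPair_self]
  have hJF : detPairL (frame g x) (paraJ n (F p)) (paraJ n (F p)) = 0 := detPair_self _ _
  have hFF : detPairL (frame g x) (paraJ n (F p)) (F p) = -D := by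
    rw [← hP, hF p hp]
  have h := congrArg (detPairL (frame g x) (paraJ n (F p))) hsd
  simp only [hC, map_add, map_sub, map_smul, hT, hP, hPJ, hJF, hFF, ← hK, smul_eq_mul] at h
  rw [← mul_left_inj' hD]
  simp only [LinearMap.add_apply, LinearMap.smul_apply, LinearMap.id_apply, map_add, map_smul,
    smul_eq_mul]
  linear_combination -h

/-- In the product basis s k is block diagonal with last entry 1; the exponent 2n + 1 is its size.
-/
theorem abs_det_metric_of_eq_hypRot {s : ℝ} {L : Module.End ℝ (RVec (2 * n))} {h₀ : LinearMap.BilinForm ℝ (RVec (2 * n))}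
    {k : LinearMap.BilinForm ℝ (RVec (2 * n + 1))}
    (hk : ∀ u v, s * k u v = h₀ (initL (2 * n) u) (L (initL (2 * n) v))
      + u (Fin.last _) * v (Fin.last _)) :
    |s| ^ (2 * n + 1) *
      |(Matrix.of fun i j => k (productBasis (2 * n) i) (productBasis (2 * n) j)).det|
      = |gramDet h₀| * |LinearMap.det L| := by
  rw [← abs_pow, ← abs_mul, ← abs_mul, ← gramDet_comp_right]
  congr 1
  have := Matrix.det_smul
    (Matrix.of fun i j => k (productBasis (2 * n) i) (productBasis (2 * n) j)) s
  rw [Fintype.card_fin] at this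
  rw [← this]
  apply det_eq_of_castSucc_block
  · intro i j
    simp [hk, initL_productBasis_castSucc, productBasis_castSucc_last]
  · intro i
    simp [hk, initL_productBasis_castSucc, initL_productBasis_last, productBasis_castSucc_last]
  · intro i
    simp [hk, initL_productBasis_castSucc, initL_productBasis_last, productBasis_castSucc_last]
  · simp [hk, initL_productBasis_last, productBasis_last_last]

end expression

/-! ### The relation between λ and the components of ζ -/

section expression

variable {n : ℕ} {V : Set (RVec (2 * n))} {g ζ : RVec (2 * n) → RVec (2 * n + 2)}
    {Γ : RVec (2 * n) → RVec (2 * n) →ₗ[ℝ] RVec (2 * n) →ₗ[ℝ] RVec (2 * n)}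
    {h₁ h₂ : RVec (2 * n) → LinearMap.BilinForm ℝ (RVec (2 * n))}
    {S : RVec (2 * n) → Module.End ℝ (RVec (2 * n))}
    {τ₁ τ₂ : RVec (2 * n) → Module.Dual ℝ (RVec (2 * n))}
    {F C : RVec (2 * n + 1) → RVec (2 * n + 2)} {U : Set (RVec (2 * n + 1))}
    {p : RVec (2 * n + 1)} {lam : ℝ}

/-- The volume normalisations of `cosh z • J g - sinh z • g` and of `g` relate the shape operator
to the `g`, `Jg`-components of the normal field `ζ`. -/
theorem abs_pow_eq_of_eq_hypRot (hn : 1 ≤ n) (hg : IsParaHolomorphicHypersurface V g)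
    (htg : IsParaTransversal V g ζ) (hig : IsParaInduced V g ζ Γ h₁ h₂ S τ₁ τ₂)
    (hH : ∀ x ∈ V, ∀ X : Fin (2 * n) → RVec (2 * n), paraVolume g ζ x X = 1 →
        |(Matrix.of fun i j => h₁ x (X i) (X j)).det| = 1)
    (hUV : ∀ p ∈ U, initL (2 * n) p ∈ V)
    (hF : ∀ p ∈ U, F p = hypRot n (p (Fin.last _)) (g (initL (2 * n) p)))
    (hfs : IsLocalHypersphere U F C lam)
    (hJ : ∀ p ∈ U, paraJ n (C p) ∈ LinearMap.range (fderiv ℝ F p).toLinearMap) (hp : p ∈ U) :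
    detPair (frame g (initL (2 * n) p)) (g (initL (2 * n) p))
        (paraJ n (g (initL (2 * n) p))) ≠ 0 ∧
      ∀ (a b : ℝ) (Y : RVec (2 * n)), ζ (initL (2 * n) p) = a • g (initL (2 * n) p)
        + b • paraJ n (g (initL (2 * n) p)) + fderiv ℝ g (initL (2 * n) p) Y →
        |a ^ 2 - b ^ 2| ^ (n + 2) = |lam| ^ (2 * n + 3) := by
  obtain ⟨ht, Γ', h, S', τ, hi, -, -, hvol, hS⟩ := hfs
  obtain ⟨hD, s, hs0, y, hC⟩ := exists_field_eq_hypRot hg hUV hF ht hJ hp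
  refine ⟨hD, fun a b Y hζ => ?_⟩
  have hx := hUV p hp
  obtain ⟨K, hK, hKK, hK1, hK2⟩ := hg.exists_tangentJ hx
  have hs : s = -lam := by
    refine coefficient_eq_neg_of_weingarten (t := τ p (Pi.single (Fin.last _) 1))
      hg hUV hF ht hJ hp ?_ hC
    rw [hi.weingarten p hp, hS p hp, LinearMap.smul_apply, LinearMap.id_apply, map_smul]
  have hmet := metric_of_eq_hypRot hg htg hig ht.isOpen hUV hF hp hi hD hC hK hζ
  have hdet := abs_det_metric_of_eq_hypRot hmet
  have hΘ := inducedVolume_sq_of_eq_hypRot hg ht.isOpen hUV hF hp hC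
  have hΘ0 : inducedVolume F C p (productBasis (2 * n)) ≠ 0 := by
    rw [← sq_pos_iff, hΘ]
    positivity
  have hgram := abs_gramDet_eq_sq hn (htg.detPair_ne_zero hx) (hH _ hx)
  have hDζ : detPair (frame g (initL (2 * n) p)) (ζ (initL (2 * n) p))
      (paraJ n (ζ (initL (2 * n) p))) = (a ^ 2 - b ^ 2) *
        detPair (frame g (initL (2 * n) p)) (g (initL (2 * n) p))
          (paraJ n (g (initL (2 * n) p))) := by
    rw [← detPair_combination _ a b (fderiv_mem_span_frame g _ Y)
      (fderiv_mem_span_frame g _ (K Y)), hζ]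
    congr 1
    simp only [map_add, map_smul, paraJ_paraJ, hK]
    abel
  -- This turns the determinant identity into |s|²ⁿ⁺¹ · s²D² = (a² - b²)²D² · |a² - b²|ⁿ.
  rw [abs_det_eq_sq_of_metricVolume_eq (hvol p hp _) hΘ0, hΘ, hgram,
    (det_add_smul_involution K hKK hK1 hK2 a b).1, abs_pow, hDζ, mul_pow] at hdet
  have hD2 := pow_ne_zero 2 hD
  rw [show |lam| = |s| by rw [hs, abs_neg]]
  apply mul_right_cancel₀ hD2
  rw [← sq_abs (a ^ 2 - b ^ 2), ← sq_abs s] at hdet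
  linear_combination -hdet

end expression

theorem eq_rpow_of_sq_pow_eq (n : ℕ) {l a : ℝ} (h : |a ^ 2| ^ (n + 2) = |l| ^ (2 * n + 3)) :
    |l| = |a| ^ ((2 * (n : ℝ) + 4) / (2 * (n : ℝ) + 3)) := by
  have h1 : |l| ^ (2 * n + 3) = |a| ^ (2 * n + 4) := by
    rw [← h, abs_pow, ← pow_mul]
    congr 1
  have h2 : (|l| ^ (2 * n + 3)) ^ (((2 * n + 3 : ℕ) : ℝ)⁻¹) = |l| :=
    Real.pow_rpow_inv_natCast (abs_nonneg l) (by omega)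
  rw [← h2, h1, ← Real.rpow_natCast, ← Real.rpow_mul (abs_nonneg a)]
  push_cast
  rfl

end AffineHypersphere

end

/-! ### The main theorem -/

theorem mainTheorem12 (n : ℕ) (hn : 1 ≤ n)
    {M : Type*} [TopologicalSpace M] [ChartedSpace (RVec (2 * n + 1)) M]
    [IsManifold 𝓘(ℝ, RVec (2 * n + 1)) ∞ M]
    (f : M → RVec (2 * n + 2)) (lam : ℝ) (hf : IsJTangentAffineHypersphere f lam)
    (V : Set (RVec (2 * n))) (g : RVec (2 * n) → RVec (2 * n + 2)) (α : ℝ)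
    (hg : IsParaComplexAffineHypersphere V g α)
    (hfg : IsRelated f V g) :
    |lam| = |α| ^ ((2 * (n : ℝ) + 4) / (2 * (n : ℝ) + 3)) := by
  obtain ⟨C, hfC, hJC⟩ := hf
  obtain ⟨hgh, ζ, htg, Γ, h₁, h₂, S, τ₁, τ₂, hig, hnd, hH, hτ₁, hτ₂, hS⟩ := hg
  obtain ⟨⟨x₀, hx₀⟩, I, -, -, ⟨z₀, hz₀⟩, e, he, het, hfe⟩ := hfg
  have hUV : ∀ p ∈ e.target, initL (2 * n) p ∈ V := fun p hp => by
    rw [het] at hp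
    exact hp.1
  have hF : ∀ p ∈ e.target, (f ∘ e.symm) p =
      hypRot n (p (Fin.last _)) (g (initL (2 * n) p)) := fun p hp => by
    rw [het] at hp
    have h := hfe _ hp.1 _ hp.2
    rw [Fin.snoc_init_self] at h
    rw [Function.comp_apply, h, hypRot_apply, initL_apply]
  have key := fun p hp => abs_pow_eq_of_eq_hypRot (p := p) hn hgh htg hig hH hUV hF
    (hfC e he) (hJC e he) hp
  have hmem : ∀ x ∈ V, ∃ p ∈ e.target, initL (2 * n) p = x := fun x hx =>
    ⟨Fin.snoc (α := fun _ => ℝ) x z₀, by rw [het]; simpa using ⟨hx, hz₀⟩, by simp [initL_apply]⟩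
  have hζ' : ∀ x ∈ V, ∀ u, fderiv ℝ ζ x u = -α • fderiv ℝ g x u := fun x hx u => by
    rw [hig.weingarten x hx, hS x hx, hτ₁ x hx, hτ₂ x hx]
    simp
  have hD : ∀ x ∈ V, detPair (frame g x) (g x) (paraJ n (g x)) ≠ 0 := fun x hx => by
    obtain ⟨p, hp, rfl⟩ := hmem x hx
    exact (key p hp).1
  -- The identity determines |a² - b²| by λ alone, so its square is the same at every point of V; c
  -- is that square.
  have hconst : ∃ c : ℝ, ∀ k : ℝ, |k| ^ (n + 2) = |lam| ^ (2 * n + 3) → k ^ 2 = c := by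
    refine ⟨((|lam| ^ (2 * n + 3)) ^ (((n + 2 : ℕ) : ℝ)⁻¹)) ^ 2, fun k hk => ?_⟩
    rw [← hk, Real.pow_rpow_inv_natCast (abs_nonneg k) (by omega), sq_abs]
  obtain ⟨c, hc⟩ := hconst
  have hquot : ∀ x ∈ V, detPair (frame g x) (ζ x) (paraJ n (ζ x)) ^ 2 =
      c * detPair (frame g x) (g x) (paraJ n (g x)) ^ 2 := fun x hx => by
    obtain ⟨K, hK, -, -, -⟩ := hgh.exists_tangentJ hx
    obtain ⟨a, b, t, ht, hζ⟩ := exists_combination_of_detPair_ne_zero (hD x hx) (ζ x)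
    rw [span_frame] at ht
    obtain ⟨Y, rfl⟩ := ht
    obtain ⟨p, hp, rfl⟩ := hmem x hx
    rw [← hc _ ((key p hp).2 a b Y hζ), ← mul_pow, ← detPair_combination _ a b
      (fderiv_mem_span_frame g _ Y) (fderiv_mem_span_frame g _ (K Y)), hζ]
    congr 2
    simp only [ContinuousLinearMap.coe_coe, map_add, map_smul, paraJ_paraJ, hK]
    abel
  have hζ := hgh.eq_neg_smul hn htg.smooth hζ' hD
    (fun x hx => hig.exists_eq_combination hgh htg hnd hζ' hD hquot hx) hx₀
  obtain ⟨p, hp, rfl⟩ := hmem x₀ hx₀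
  -- Since ζ = -αg, the components are a = -α, b = 0, Y = 0.
  have h := (key p hp).2 (-α) 0 0 (by rw [hζ]; simp)
  apply eq_rpow_of_sq_pow_eq
  simpa using h
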